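/- All graphs are finite and simple. A *grid* is the Cartesian product of two paths, and every single path in it is simple. A *bend* of a path in a grid is an internal vertex of the path at which it has one horizontal and one vertical edge. Two paths $P,P'$ of a grid *split* if some vertex has degree at least $3$ in $P\cup P'$; write $P\sim P'$ if $P$ and $P'$ have a common edge and do not split. A graph $G$ is *$B_1$-ENPG* if there are a grid and paths $(P_v)_{v\in V(G)}$ in it (not necessarily distinct), each with at most one bend, such that distinct vertices $u,v$ are adjacent in $G$ if and only if $P_u\sim P_v$. **Theorem.** Let $G=S(K,S,E)$ be a connected split graph, i.e. $V(G)$ is the disjoint union of a clique $K$ and a stable set $S$, and suppose that no vertex of $S$ is adjacent to all vertices of $K$. Then $G$ is $B_1$-ENPG if and only if there exist - two partitions $\{K_{L,H},K_{L,V}\}$ and $\{K_{R,H},K_{R,V}\}$ of $K$ with $K_{L,V}\cap K_{R,V}=\emptyset$, - a permutation (linear ordering) $\sigma_{X,Y}$ of $K_{X,Y}$ for every $(X,Y)\in\{L,R\}\times\{H,V\}$, - a partition of $S$ into eight classes $S_{X,H},S_{X,V},S_{X,HH},S_{X,HV}$, $X\in\{L,R\}$, and - for every $s\in S$, a sequence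 $\sigma_s$ of consecutive elements of one of the $\sigma_{X,Y}$, as specified in (i)–(iii), such that the following hold for all $X\in\{L,R\}$ and $Y\in\{H,V\}$, where $\bar X$ denotes the other element of $\{L,R\}$. (Parts of partitions, intervals, prefixes and suffixes may be empty, and $\sigma_s$ also denotes its set of elements.) 1. (i) If $s\in S_{X,Y}$, then $\sigma_s$ is an interval of $\sigma_{X,Y}$ and $N(s)=\sigma_s$. 2. (ii) If $s\in S_{X,HH}$, then $\sigma_s$ is a prefix of $\sigma_{X,H}$ and $N(s)=\sigma_s\cap K_{\bar X,H}$. 3. (iii) If $s\in S_{X,HV}$, then $\sigma_s$ is a suffix of $\sigma_{X,H}$ and $N(s)=\sigma_s\cup K_{X,V}$. 4. (iv) If $s\in S_{X,H}\cup S_{X,HH}$, then there is at most one $s'\in S_{X,HV}$ such that $\sigma_s$ and $\sigma_{s'}$ overlap, i.e. they intersect and neither contains the other. 5. (v) If $S_{X,HH}\neq\emptyset$, then $|S_{\bar X,HV}|\le 1$. 6. (vi) $K_{X,V}\subseteq K_{\bar X,H}$. -/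

import Mathlib

namespace BENPG

/-- A simple path (no repeated vertex) of the graph `H`. -/
structure HostPath {W : Type*} (H : SimpleGraph W) where
  src : W
  tgt : W
  walk : H.Walk src tgt
  isPath : walk.IsPath

/-- The set of edges of a path. -/
def HostPath.edges {W : Type*} {H : SimpleGraph W} (P : HostPath H) : Set (Sym2 W) :=
  {e | e ∈ P.walk.edges}

/-- A split of `P` and `Q`: a vertex of degree at least `3` in the union `P ∪ Q`. -/
def IsSplit {W : Type*} {H : SimpleGraph W} (P Q : HostPath H) (w : W) : Prop :=
  3 ≤ {e : Sym2 W | e ∈ P.edges ∪ Q.edges ∧ w ∈ e}.ncard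

/-- `P ∼ Q`: the paths have a common edge and no split. -/
def NonSplitting {W : Type*} {H : SimpleGraph W} (P Q : HostPath H) : Prop :=
  (P.edges ∩ Q.edges).Nonempty ∧ ∀ w, ¬ IsSplit P Q w

/-- The rectangular grid: the Cartesian product of two paths. The first coordinate of a vertex is
its column, the second one its row. -/
def grid (m n : ℕ) : SimpleGraph (Fin m × Fin n) :=
  SimpleGraph.boxProd (SimpleGraph.pathGraph m) (SimpleGraph.pathGraph n)

/-- A bend of a path in a grid: a vertex at which the path has both a horizontal edge
(to a vertex in the same row) and a vertical edge (to a vertex in the same column).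
Such a vertex is incident to two edges of the path, hence internal. -/
def IsBend {m n : ℕ} (P : HostPath (grid m n)) (w : Fin m × Fin n) : Prop :=
  (∃ x, s(w, x) ∈ P.edges ∧ x.2 = w.2) ∧ (∃ y, s(w, y) ∈ P.edges ∧ y.1 = w.1)

/-- `G` is a `B_k`-ENPG graph: there are paths `P v` in some grid, indexed by the vertices of `G`
(different vertices may have the same path) and each with at most `k` bends, such that two
vertices are adjacent iff their paths share an edge and do not split. -/
def IsBENPG {V : Type*} (k : ℕ) (G : SimpleGraph V) : Prop :=
  ∃ (m n : ℕ) (P : V → HostPath (grid m n)),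
    (∀ v, {w | IsBend (P v) w}.ncard ≤ k) ∧
    ∀ u v, u ≠ v → (G.Adj u v ↔ NonSplitting (P u) (P v))

/-- `G = S(K, S, E)`: the vertex set is partitioned into the clique `K` and the stable set `S`. -/
structure IsSplitGraph {V : Type*} (G : SimpleGraph V) (K S : Set V) : Prop where
  disjoint : Disjoint K S
  union_eq : K ∪ S = Set.univ
  clique : G.IsClique K
  stable : G.IsIndepSet S

/-- The index `X ∈ {L, R}`. -/
inductive Side
  | L
  | R

/-- The complementary index `X̄`. -/
def Side.bar : Side → Side
  | .L => .R
  | .R => .L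

/-- The index `Y ∈ {H, V}`. -/
inductive Dir
  | H
  | V

/-- The second indices of the classes `S_{X,H}`, `S_{X,V}`, `S_{X,HH}`, `S_{X,HV}`. -/
inductive Cls
  | H
  | V
  | HH
  | HV

/-- The class index `Y` of `S_{X,Y}`. -/
def Dir.cls : Dir → Cls
  | .H => .H
  | .V => .V

/-- The set of entries of a list. -/
def entries {V : Type*} (l : List V) : Set V := {v | v ∈ l}

/-- The list `σ` is a permutation (linear ordering) of the set `A`. -/
def IsOrdering {V : Type*} (σ : List V) (A : Set V) : Prop :=
  σ.Nodup ∧ entries σ = A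

/-- Two sets overlap: they intersect and neither contains the other. -/
def Overlap {V : Type*} (A B : Set V) : Prop :=
  (A ∩ B).Nonempty ∧ ¬ A ⊆ B ∧ ¬ B ⊆ A

end BENPG

/-!
The proof replaces grids by integer arithmetic and passes through a normal form of the layouts on
the right-hand side.

**Shapes.** A path with at most one bend is determined by its corner and its two ends, and is
recorded as a `Shape` in the integer grid; `isBENPG_one_iff` says that a graph is `B₁`-ENPG iff
shapes can be assigned to its vertices so that adjacency is the relation `Shape.Sim`. Two shapes
with a common edge split only where one of them bends, which gives the quantifier-free description
`Shape.sim_iff` of this relation.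

**Normal form.** If no vertex has class `S_{X̄,HH}`, then the orders of `K_{X,H}` and `K_{X,V}` can
be concatenated, and all vertices of `S_{X,V}` and `S_{X,HV}` become members of `S_{X,H}`.
Otherwise `S_{X,HV}` has at most one element by assumption. So it may always be assumed that
`S_{L,HV}` and `S_{R,HV}` have at most one element (`IsLayout.exists_normal`), and then both
cardinality bounds in the theorem, in particular the one on overlaps, hold trivially. The inclusion
of `K_{X,V}` in `K_{X̄,H}` follows from the disjointness of `K_{L,V}` and `K_{R,V}`.

**From a representation to a layout.** The shapes of the vertices of `K` share one edge, horizontal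
without loss of generality (`exists_bundle`): a pair without common horizontal edges and a pair
without common vertical edges cannot coexist, so Helly's theorem for intervals applies. The sets
`K_{L,V}` and `K_{R,V}` consist of the vertices whose shapes bend to the left or to the right of
that edge; the orders are given by the ends of the shapes. The shape of a vertex of `S` meets the
union of the shapes of `K`, a path with at most two bends, in an interval, and the ways in which it
can leave that path at either end of the interval give its class (`exists_form`). If the shape `P`
has class `S_{X,HH}`, then a shape of class `S_{X̄,HV}` that is not related to `P` has to turn at
the corner which `P` passes straight through, and two shapes that do so are related
(`sim_of_runsAlong`); hence at most one vertex has class `S_{X̄,HV}`.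

**From a layout to a representation.** In normal form, the ends of the shapes of `K` are put at
multiples of a large number `D`, in the prescribed order, and a vertex of `S` leaves the union of
the shapes of `K` at a point of its own, which forces two vertices of `S` to split or to be
edge-disjoint. The only exception would be two shapes of class `S_{X,HV}`, which the normal form
excludes (`isBENPG_of_normal_layout`).
-/

namespace BENPG

/-! ### Bent paths of the integer grid -/

/-- A path of the integer grid with at most one bend, given by a horizontal arm from `(ex, cy)` to
the corner `(cx, cy)` and a vertical arm from the corner to `(cx, ey)`. Either arm may be trivial,
so a straight path has several encodings. -/
structure Shape where
  cx : ℤ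
  cy : ℤ
  ex : ℤ
  ey : ℤ

namespace Shape

/-- The edge from `(x, y)` to `(x + 1, y)` lies on the horizontal arm. -/
def H (T : Shape) (x y : ℤ) : Prop :=
  y = T.cy ∧ ((T.cx ≤ x ∧ x < T.ex) ∨ (T.ex ≤ x ∧ x < T.cx))

/-- The edge from `(x, y)` to `(x, y + 1)` lies on the vertical arm. -/
def V (T : Shape) (x y : ℤ) : Prop :=
  x = T.cx ∧ ((T.cy ≤ y ∧ y < T.ey) ∨ (T.ey ≤ y ∧ y < T.cy))

/-- The two shapes have a common edge. -/
def Share (T T' : Shape) : Prop :=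
  ∃ x y, (T.H x y ∧ T'.H x y) ∨ (T.V x y ∧ T'.V x y)

/-- At least three of the four grid edges at `(x, y)` lie on `T` or `T'`. -/
def Split (T T' : Shape) (x y : ℤ) : Prop :=
  ((T.H x y ∨ T'.H x y) ∧ (T.H (x - 1) y ∨ T'.H (x - 1) y) ∧ (T.V x y ∨ T'.V x y)) ∨
  ((T.H x y ∨ T'.H x y) ∧ (T.H (x - 1) y ∨ T'.H (x - 1) y) ∧
    (T.V x (y - 1) ∨ T'.V x (y - 1))) ∨
  ((T.H x y ∨ T'.H x y) ∧ (T.V x y ∨ T'.V x y) ∧ (T.V x (y - 1) ∨ T'.V x (y - 1))) ∨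
  ((T.H (x - 1) y ∨ T'.H (x - 1) y) ∧ (T.V x y ∨ T'.V x y) ∧ (T.V x (y - 1) ∨ T'.V x (y - 1)))

/-- The relation `∼` on shapes: a common edge and no split. -/
def Sim (T T' : Shape) : Prop := T.Share T' ∧ ∀ x y, ¬ T.Split T' x y

end Shape

/-- The edge from `(x, y)` to its right neighbour. -/
def hEdge (x y : ℤ) : Sym2 (ℤ × ℤ) := s((x, y), (x + 1, y))

/-- The edge from `(x, y)` to its upper neighbour. -/
def vEdge (x y : ℤ) : Sym2 (ℤ × ℤ) := s((x, y), (x, y + 1))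

/-- The set of edges of a shape. -/
def Shape.edges (T : Shape) : Set (Sym2 (ℤ × ℤ)) :=
  {e | ∃ x y, (T.H x y ∧ e = hEdge x y) ∨ (T.V x y ∧ e = vEdge x y)}

theorem hEdge_inj {x y x' y' : ℤ} : hEdge x y = hEdge x' y' ↔ x = x' ∧ y = y' := by
  simp only [hEdge, Sym2.eq_iff, Prod.mk.injEq]; omega

theorem vEdge_inj {x y x' y' : ℤ} : vEdge x y = vEdge x' y' ↔ x = x' ∧ y = y' := by
  simp only [vEdge, Sym2.eq_iff, Prod.mk.injEq]; omega

theorem hEdge_ne_vEdge {x y x' y' : ℤ} : hEdge x y ≠ vEdge x' y' := by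
  simp only [hEdge, vEdge, ne_eq, Sym2.eq_iff, Prod.mk.injEq]; omega

theorem hEdge_mem_edges {T : Shape} {x y : ℤ} : hEdge x y ∈ T.edges ↔ T.H x y := by
  constructor
  · rintro ⟨a, b, ⟨h, e⟩ | ⟨h, e⟩⟩
    · obtain ⟨rfl, rfl⟩ := hEdge_inj.1 e; exact h
    · exact (hEdge_ne_vEdge e).elim
  · exact fun h => ⟨x, y, .inl ⟨h, rfl⟩⟩

theorem vEdge_mem_edges {T : Shape} {x y : ℤ} : vEdge x y ∈ T.edges ↔ T.V x y := by
  constructor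
  · rintro ⟨a, b, ⟨h, e⟩ | ⟨h, e⟩⟩
    · exact (hEdge_ne_vEdge e.symm).elim
    · obtain ⟨rfl, rfl⟩ := vEdge_inj.1 e; exact h
  · exact fun h => ⟨x, y, .inr ⟨h, rfl⟩⟩

theorem mem_hEdge {x y a b : ℤ} : (x, y) ∈ hEdge a b ↔ b = y ∧ (a = x ∨ a = x - 1) := by
  simp only [hEdge, Sym2.mem_iff, Prod.mk.injEq]; omega

theorem mem_vEdge {x y a b : ℤ} : (x, y) ∈ vEdge a b ↔ a = x ∧ (b = y ∨ b = y - 1) := by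
  simp only [vEdge, Sym2.mem_iff, Prod.mk.injEq]; omega

theorem share_iff {T T' : Shape} : (T.edges ∩ T'.edges).Nonempty ↔ T.Share T' := by
  constructor
  · rintro ⟨e, ⟨x, y, ⟨h, rfl⟩ | ⟨h, rfl⟩⟩, h'⟩
    · exact ⟨x, y, .inl ⟨h, hEdge_mem_edges.1 h'⟩⟩
    · exact ⟨x, y, .inr ⟨h, vEdge_mem_edges.1 h'⟩⟩
  · rintro ⟨x, y, ⟨h, h'⟩ | ⟨h, h'⟩⟩
    · exact ⟨hEdge x y, hEdge_mem_edges.2 h, hEdge_mem_edges.2 h'⟩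
    · exact ⟨vEdge x y, vEdge_mem_edges.2 h, vEdge_mem_edges.2 h'⟩

/-- At most four edges of two shapes meet at `(x, y)`. -/
theorem incident_eq (T T' : Shape) (x y : ℤ) :
    {e | e ∈ T.edges ∪ T'.edges ∧ (x, y) ∈ e} =
      {e | (e = hEdge x y ∧ (T.H x y ∨ T'.H x y)) ∨
        (e = hEdge (x - 1) y ∧ (T.H (x - 1) y ∨ T'.H (x - 1) y)) ∨
        (e = vEdge x y ∧ (T.V x y ∨ T'.V x y)) ∨
        (e = vEdge x (y - 1) ∧ (T.V x (y - 1) ∨ T'.V x (y - 1)))} := by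
  ext e
  constructor
  · rintro ⟨⟨a, b, ⟨h, rfl⟩ | ⟨h, rfl⟩⟩ | ⟨a, b, ⟨h, rfl⟩ | ⟨h, rfl⟩⟩, hm⟩
    · obtain ⟨rfl, rfl | rfl⟩ := mem_hEdge.1 hm <;> simp [h]
    · obtain ⟨rfl, rfl | rfl⟩ := mem_vEdge.1 hm <;> simp [h]
    · obtain ⟨rfl, rfl | rfl⟩ := mem_hEdge.1 hm <;> simp [h]
    · obtain ⟨rfl, rfl | rfl⟩ := mem_vEdge.1 hm <;> simp [h]
  · rintro (⟨rfl, h⟩ | ⟨rfl, h⟩ | ⟨rfl, h⟩ | ⟨rfl, h⟩) <;>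
      simp [hEdge_mem_edges, vEdge_mem_edges, mem_hEdge, mem_vEdge, h]

theorem three_le_ncard_iff {α : Type*} {a b c d : α} (hab : a ≠ b) (hac : a ≠ c) (had : a ≠ d)
    (hbc : b ≠ c) (hbd : b ≠ d) (hcd : c ≠ d) (p q r t : Prop) :
    3 ≤ {e | (e = a ∧ p) ∨ (e = b ∧ q) ∨ (e = c ∧ r) ∨ (e = d ∧ t)}.ncard ↔
      (p ∧ q ∧ r) ∨ (p ∧ q ∧ t) ∨ (p ∧ r ∧ t) ∨ (q ∧ r ∧ t) := by
  classical
  have key : {e | (e = a ∧ p) ∨ (e = b ∧ q) ∨ (e = c ∧ r) ∨ (e = d ∧ t)} =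
      ((({a, b, c, d} : Finset α).filter fun e =>
        (e = a ∧ p) ∨ (e = b ∧ q) ∨ (e = c ∧ r) ∨ (e = d ∧ t) : Finset α) : Set α) := by
    ext e; simp; tauto
  rw [key, Set.ncard_coe_finset]
  by_cases p <;> by_cases q <;> by_cases r <;> by_cases t <;>
    simp_all [Finset.filter_insert, Finset.filter_singleton, Ne.symm]

theorem three_le_degree_iff (T T' : Shape) (x y : ℤ) :
    3 ≤ {e | e ∈ T.edges ∪ T'.edges ∧ (x, y) ∈ e}.ncard ↔ T.Split T' x y := by
  rw [incident_eq, three_le_ncard_iff, Shape.Split]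
  · rw [Ne, hEdge_inj]; omega
  · exact hEdge_ne_vEdge
  · exact hEdge_ne_vEdge
  · exact hEdge_ne_vEdge
  · exact hEdge_ne_vEdge
  · rw [Ne, vEdge_inj]; omega

/-- The embedding of a finite grid into the integer grid. -/
def toInt {m n : ℕ} (w : Fin m × Fin n) : ℤ × ℤ := (w.1.val, w.2.val)

theorem toInt_injective {m n : ℕ} : Function.Injective (toInt (m := m) (n := n)) := by
  rintro ⟨a, b⟩ ⟨c, d⟩ h
  simp only [toInt, Prod.mk.injEq, Nat.cast_inj, Fin.val_inj] at h
  exact Prod.ext h.1 h.2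

/-- The shape `T` has the same edges as the path `P`. -/
def Represents {m n : ℕ} (T : Shape) (P : HostPath (grid m n)) : Prop :=
  Sym2.map toInt '' P.edges = T.edges

/-- The relation `∼` on grid paths only depends on the edges, so it can be read off the shapes. -/
theorem Represents.nonSplitting_iff {m n : ℕ} {T T' : Shape} {P P' : HostPath (grid m n)}
    (h : Represents T P) (h' : Represents T' P') : NonSplitting P P' ↔ T.Sim T' := by
  have inj := Sym2.map.injective (toInt_injective (m := m) (n := n))
  unfold NonSplitting Shape.Sim
  rw [← share_iff, ← h, ← h', ← Set.image_inter inj, Set.image_nonempty]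
  have hspl : ∀ w, IsSplit P P' w ↔ T.Split T' (toInt w).1 (toInt w).2 := by
    intro w
    rw [← three_le_degree_iff, IsSplit, ← Set.ncard_image_of_injective _ inj, ← h, ← h']
    suffices hs : Sym2.map toInt '' {e | e ∈ P.edges ∪ P'.edges ∧ w ∈ e} =
        {e | e ∈ Sym2.map toInt '' P.edges ∪ Sym2.map toInt '' P'.edges ∧ toInt w ∈ e} by
      rw [hs]
    rw [← Set.image_union]
    ext e
    constructor
    · rintro ⟨e, ⟨he, hw⟩, rfl⟩
      exact ⟨⟨e, he, rfl⟩, Sym2.mem_map.2 ⟨w, hw, rfl⟩⟩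
    · rintro ⟨⟨e, he, rfl⟩, hw⟩
      obtain ⟨w', hw', hww⟩ := Sym2.mem_map.1 hw
      exact ⟨e, ⟨he, toInt_injective hww ▸ hw'⟩, rfl⟩
  refine and_congr_right fun _ => ⟨fun hn x y hs => ?_, fun hn w hs => hn _ _ ((hspl w).1 hs)⟩
  have h3 := (three_le_degree_iff _ _ _ _).2 hs
  obtain ⟨e, he, hw⟩ := Set.nonempty_of_ncard_ne_zero (Nat.ne_zero_of_lt h3)
  rw [← h, ← h', ← Set.image_union] at he
  obtain ⟨e, -, rfl⟩ := he
  obtain ⟨w, -, hww⟩ := Sym2.mem_map.1 hw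
  refine hn w ((hspl w).2 ?_)
  rw [hww]; exact hs

/-! ### Paths with at most one bend are shapes -/

/-- A sequence of distinct, consecutively adjacent vertices is a path. -/
theorem exists_hostPath {W : Type*} {H : SimpleGraph W} (γ : ℕ → W) (k : ℕ)
    (hadj : ∀ i < k, H.Adj (γ i) (γ (i + 1))) (hinj : ∀ i ≤ k, ∀ j ≤ k, γ i = γ j → i = j) :
    ∃ P : HostPath H, P.edges = {e | ∃ i < k, e = s(γ i, γ (i + 1))} := by
  suffices h : ∃ p : H.Walk (γ k) (γ 0), p.IsPath ∧ (∀ w ∈ p.support, ∃ i ≤ k, w = γ i) ∧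
      ∀ e, e ∈ p.edges ↔ ∃ i < k, e = s(γ i, γ (i + 1)) by
    obtain ⟨p, hp, -, he⟩ := h
    exact ⟨⟨_, _, p, hp⟩, Set.ext he⟩
  induction k with
  | zero => exact ⟨.nil, by simp, by simp, by simp⟩
  | succ k ih =>
    obtain ⟨p, hp, hs, he⟩ := ih (fun i hi => hadj i (by omega))
      fun i hi j hj => hinj i (by omega) j (by omega)
    refine ⟨.cons (hadj k (by omega)).symm p, ?_, ?_, ?_⟩
    · rw [SimpleGraph.Walk.cons_isPath_iff]
      refine ⟨hp, fun h => ?_⟩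
      obtain ⟨i, hi, hh⟩ := hs _ h
      have := hinj _ le_rfl i (by omega) hh
      omega
    · intro w hw
      rw [SimpleGraph.Walk.support_cons, List.mem_cons] at hw
      rcases hw with rfl | hw
      · exact ⟨k + 1, le_rfl, rfl⟩
      · obtain ⟨i, hi, rfl⟩ := hs w hw
        exact ⟨i, by omega, rfl⟩
    · intro e
      rw [SimpleGraph.Walk.edges_cons, List.mem_cons, he]
      constructor
      · rintro (rfl | ⟨i, hi, rfl⟩)
        · exact ⟨k, by omega, Sym2.eq_swap⟩
        · exact ⟨i, by omega, rfl⟩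
      · rintro ⟨i, hi, rfl⟩
        rcases Nat.lt_succ_iff_lt_or_eq.1 hi with h | rfl
        · exact .inr ⟨i, h, rfl⟩
        · exact .inl Sym2.eq_swap

theorem grid_adj_iff {m n : ℕ} {u v : Fin m × Fin n} :
    (grid m n).Adj u v ↔
      ((toInt u).2 = (toInt v).2 ∧
        ((toInt u).1 + 1 = (toInt v).1 ∨ (toInt v).1 + 1 = (toInt u).1)) ∨
      ((toInt u).1 = (toInt v).1 ∧
        ((toInt u).2 + 1 = (toInt v).2 ∨ (toInt v).2 + 1 = (toInt u).2)) := by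
  simp only [grid, SimpleGraph.boxProd_adj, SimpleGraph.pathGraph_adj, toInt, Fin.ext_iff]
  omega

/-- The points of a shape, numbered from the horizontal end to the vertical end. -/
def Shape.point (T : Shape) (i : ℕ) : ℤ × ℤ :=
  if i ≤ (T.cx - T.ex).natAbs then
    (if T.ex ≤ T.cx then T.ex + i else T.ex - i, T.cy)
  else
    (T.cx, if T.cy ≤ T.ey then T.cy + (i - (T.cx - T.ex).natAbs)
      else T.cy - (i - (T.cx - T.ex).natAbs))


theorem Shape.point_spec (T : Shape) (i : ℕ) :
    (i ≤ (T.cx - T.ex).natAbs ∧ (T.point i).2 = T.cy ∧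
      ((T.ex ≤ T.cx ∧ (T.point i).1 = T.ex + i) ∨ (T.cx < T.ex ∧ (T.point i).1 = T.ex - i))) ∨
    ((T.cx - T.ex).natAbs < i ∧ (T.point i).1 = T.cx ∧
      ((T.cy ≤ T.ey ∧ (T.point i).2 = T.cy + (i - (T.cx - T.ex).natAbs)) ∨
        (T.ey < T.cy ∧ (T.point i).2 = T.cy - (i - (T.cx - T.ex).natAbs)))) := by
  unfold point
  split_ifs <;> simp only [true_and, and_true] <;> omega

theorem Shape.edges_eq_points (T : Shape) :
    {e | ∃ i < (T.cx - T.ex).natAbs + (T.cy - T.ey).natAbs,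
      e = s(T.point i, T.point (i + 1))} = T.edges := by
  ext e
  constructor
  · rintro ⟨i, hi, rfl⟩
    have h1 := T.point_spec i
    have h2 := T.point_spec (i + 1)
    rcases lt_or_ge i (T.cx - T.ex).natAbs with h | h
    · refine ⟨min (T.point i).1 (T.point (i + 1)).1, T.cy, .inl ⟨⟨rfl, by omega⟩, ?_⟩⟩
      simp only [hEdge, Sym2.eq_iff, Prod.ext_iff]
      omega
    · refine ⟨T.cx, min (T.point i).2 (T.point (i + 1)).2, .inr ⟨⟨rfl, by omega⟩, ?_⟩⟩
      simp only [vEdge, Sym2.eq_iff, Prod.ext_iff]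
      omega
  · rintro ⟨x, y, ⟨⟨rfl, h⟩, rfl⟩ | ⟨⟨rfl, h⟩, rfl⟩⟩
    · obtain ⟨i, hi⟩ : ∃ i : ℕ, (T.cx ≤ T.ex ∧ (i : ℤ) = T.ex - x - 1) ∨
          (T.ex < T.cx ∧ (i : ℤ) = x - T.ex) := by
        rcases h with h | h
        · exact ⟨(T.ex - x - 1).toNat, by omega⟩
        · exact ⟨(x - T.ex).toNat, by omega⟩
      have h1 := T.point_spec i
      have h2 := T.point_spec (i + 1)
      refine ⟨i, by omega, ?_⟩
      simp only [hEdge, Sym2.eq_iff, Prod.ext_iff]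
      omega
    · obtain ⟨i, hi⟩ : ∃ i : ℕ, (T.cy ≤ T.ey ∧ (i : ℤ) = (T.cx - T.ex).natAbs + (y - T.cy)) ∨
          (T.ey < T.cy ∧ (i : ℤ) = (T.cx - T.ex).natAbs + (T.cy - y - 1)) := by
        rcases h with h | h
        · exact ⟨((T.cx - T.ex).natAbs + (y - T.cy)).toNat, by omega⟩
        · exact ⟨((T.cx - T.ex).natAbs + (T.cy - y - 1)).toNat, by omega⟩
      have h1 := T.point_spec i
      have h2 := T.point_spec (i + 1)
      refine ⟨i, by omega, ?_⟩
      simp only [vEdge, Sym2.eq_iff, Prod.ext_iff]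
      omega

theorem Shape.point_injOn (T : Shape) : ∀ i ≤ (T.cx - T.ex).natAbs + (T.cy - T.ey).natAbs,
    ∀ j ≤ (T.cx - T.ex).natAbs + (T.cy - T.ey).natAbs, T.point i = T.point j → i = j := by
  intro i hi j hj h
  simp only [point] at h
  split_ifs at h <;> simp only [Prod.mk.injEq] at h <;> omega

/-- A horizontal edge and a vertical edge of the edge set `E` meet at `(x, y)`. -/
def BendAt (E : Set (Sym2 (ℤ × ℤ))) (x y : ℤ) : Prop :=
  (hEdge x y ∈ E ∨ hEdge (x - 1) y ∈ E) ∧ (vEdge x y ∈ E ∨ vEdge x (y - 1) ∈ E)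

theorem horizontal_neighbour {m n : ℕ} {w x : Fin m × Fin n} (h : (grid m n).Adj w x)
    (hx : x.2 = w.2) :
    Sym2.map toInt s(w, x) = hEdge (toInt w).1 (toInt w).2 ∨
      Sym2.map toInt s(w, x) = hEdge ((toInt w).1 - 1) (toInt w).2 := by
  have h2 : (toInt x).2 = (toInt w).2 := by simp [toInt, hx]
  rw [grid_adj_iff] at h
  simp only [Sym2.map_mk, hEdge, Sym2.eq_iff, Prod.ext_iff, and_true, true_and]
  omega

theorem vertical_neighbour {m n : ℕ} {w x : Fin m × Fin n} (h : (grid m n).Adj w x)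
    (hx : x.1 = w.1) :
    Sym2.map toInt s(w, x) = vEdge (toInt w).1 (toInt w).2 ∨
      Sym2.map toInt s(w, x) = vEdge (toInt w).1 ((toInt w).2 - 1) := by
  have h2 : (toInt x).1 = (toInt w).1 := by simp [toInt, hx]
  rw [grid_adj_iff] at h
  simp only [Sym2.map_mk, vEdge, Sym2.eq_iff, Prod.ext_iff, true_and]
  omega

/-- Bends of a grid path are bends of its set of edges in the integer grid. The converse is
`BendAt.isBend`. -/
theorem IsBend.bendAt {m n : ℕ} {P : HostPath (grid m n)} {w : Fin m × Fin n} (h : IsBend P w) :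
    BendAt (Sym2.map toInt '' P.edges) (toInt w).1 (toInt w).2 := by
  obtain ⟨⟨x, hx, hxw⟩, y, hy, hyw⟩ := h
  constructor
  · rcases horizontal_neighbour (P.walk.adj_of_mem_edges hx) hxw with e | e
    · exact .inl (e ▸ Set.mem_image_of_mem _ hx)
    · exact .inr (e ▸ Set.mem_image_of_mem _ hx)
  · rcases vertical_neighbour (P.walk.adj_of_mem_edges hy) hyw with e | e
    · exact .inl (e ▸ Set.mem_image_of_mem _ hy)
    · exact .inr (e ▸ Set.mem_image_of_mem _ hy)

theorem mem_image_edges {m n : ℕ} {P : HostPath (grid m n)} {a b : ℤ × ℤ}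
    (h : s(a, b) ∈ Sym2.map toInt '' P.edges) :
    ∃ u v, toInt u = a ∧ toInt v = b ∧ s(u, v) ∈ P.edges := by
  obtain ⟨e, he, h⟩ := h
  induction e using Sym2.ind with
  | _ u v =>
    rw [Sym2.map_mk, Sym2.eq_iff] at h
    rcases h with ⟨h1, h2⟩ | ⟨h1, h2⟩
    · exact ⟨u, v, h1, h2, he⟩
    · exact ⟨v, u, h2, h1, by rwa [Sym2.eq_swap]⟩

theorem BendAt.isBend {m n : ℕ} {P : HostPath (grid m n)} {x y : ℤ}
    (h : BendAt (Sym2.map toInt '' P.edges) x y) : ∃ w, toInt w = (x, y) ∧ IsBend P w := by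
  have hH : ∃ w v, toInt w = (x, y) ∧ s(w, v) ∈ P.edges ∧ v.2 = w.2 := by
    rcases h.1 with h | h
    · obtain ⟨u, v, hu, hv, he⟩ := mem_image_edges h
      refine ⟨u, v, hu, he, ?_⟩
      simp only [toInt, Prod.mk.injEq, Fin.ext_iff] at *; omega
    · obtain ⟨u, v, hu, hv, he⟩ := mem_image_edges h
      refine ⟨v, u, by rw [hv]; simp, by rwa [Sym2.eq_swap], ?_⟩
      simp only [toInt, Prod.mk.injEq, Fin.ext_iff] at *; omega
  have hV : ∃ w v, toInt w = (x, y) ∧ s(w, v) ∈ P.edges ∧ v.1 = w.1 := by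
    rcases h.2 with h | h
    · obtain ⟨u, v, hu, hv, he⟩ := mem_image_edges h
      refine ⟨u, v, hu, he, ?_⟩
      simp only [toInt, Prod.mk.injEq, Fin.ext_iff] at *; omega
    · obtain ⟨u, v, hu, hv, he⟩ := mem_image_edges h
      refine ⟨v, u, by rw [hv]; simp, by rwa [Sym2.eq_swap], ?_⟩
      simp only [toInt, Prod.mk.injEq, Fin.ext_iff] at *; omega
  obtain ⟨w, v, hw, he, hv⟩ := hH
  obtain ⟨w', v', hw', he', hv'⟩ := hV
  obtain rfl := toInt_injective (hw.trans hw'.symm)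
  exact ⟨w, hw, ⟨v, he, hv⟩, v', he', hv'⟩

theorem Shape.bendAt_edges {T : Shape} {x y : ℤ} :
    BendAt T.edges x y ↔ (T.H x y ∨ T.H (x - 1) y) ∧ (T.V x y ∨ T.V x (y - 1)) := by
  simp only [BendAt, hEdge_mem_edges, vEdge_mem_edges]

/-- Every shape inside the box `[0, m) × [0, n)` is a path of the grid with at most one bend. -/
theorem Shape.exists_represents (T : Shape) {m n : ℕ}
    (hcx : 0 ≤ T.cx ∧ T.cx < m) (hex : 0 ≤ T.ex ∧ T.ex < m)
    (hcy : 0 ≤ T.cy ∧ T.cy < n) (hey : 0 ≤ T.ey ∧ T.ey < n) :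
    ∃ P : HostPath (grid m n), Represents T P ∧ {w | IsBend P w}.ncard ≤ 1 := by
  set k := (T.cx - T.ex).natAbs + (T.cy - T.ey).natAbs with hk
  have hpt : ∀ i, ∃ w : Fin m × Fin n, toInt w = T.point (min i k) := by
    intro i
    have hb : (0 ≤ (T.point (min i k)).1 ∧ (T.point (min i k)).1 < m) ∧
        0 ≤ (T.point (min i k)).2 ∧ (T.point (min i k)).2 < n := by
      simp only [point]
      split_ifs <;> simp only <;> omega
    refine ⟨(⟨(T.point (min i k)).1.toNat, by omega⟩, ⟨(T.point (min i k)).2.toNat, by omega⟩), ?_⟩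
    simp only [toInt]
    ext <;> simp only <;> omega
  choose γ hγ using hpt
  obtain ⟨P, hP⟩ := exists_hostPath (H := grid m n) γ k
    (by
      intro i hi
      have h : s(T.point i, T.point (i + 1)) ∈ T.edges := by
        rw [← T.edges_eq_points]; exact ⟨i, hi, rfl⟩
      rw [grid_adj_iff, hγ, hγ, min_eq_left (by omega), min_eq_left (by omega)]
      obtain ⟨x, y, ⟨-, h⟩ | ⟨-, h⟩⟩ := h
      · simp only [hEdge, Sym2.eq_iff, Prod.ext_iff] at h
        omega
      · simp only [vEdge, Sym2.eq_iff, Prod.ext_iff] at h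
        omega)
    (by
      intro i hi j hj h
      have h' := congrArg toInt h
      rw [hγ, hγ, min_eq_left hi, min_eq_left hj] at h'
      exact T.point_injOn i hi j hj h')
  have hrep : Represents T P := by
    rw [Represents, hP, ← T.edges_eq_points]
    ext e
    constructor
    · rintro ⟨e, ⟨i, hi, rfl⟩, rfl⟩
      refine ⟨i, hi, ?_⟩
      rw [Sym2.map_mk, hγ, hγ, min_eq_left (by omega), min_eq_left (by omega)]
    · rintro ⟨i, hi, rfl⟩
      refine ⟨_, ⟨i, hi, rfl⟩, ?_⟩
      rw [Sym2.map_mk, hγ, hγ, min_eq_left (by omega), min_eq_left (by omega)]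
  refine ⟨P, hrep, (Set.ncard_le_one_iff).2 ?_⟩
  have hc : ∀ w, IsBend P w → toInt w = (T.cx, T.cy) := by
    intro w hw
    have := hw.bendAt
    rw [hrep, Shape.bendAt_edges] at this
    simp only [H, V] at this
    ext <;> simp only <;> omega
  intro a b ha hb
  exact toInt_injective ((hc a ha).trans (hc b hb).symm)


theorem Shape.edges_eq_insert_hEdge {T T' : Shape} {a b : ℤ}
    (hH : ∀ x y, T.H x y ↔ T'.H x y ∨ (x = a ∧ y = b)) (hV : ∀ x y, T.V x y ↔ T'.V x y) :
    T.edges = insert (hEdge a b) T'.edges := by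
  ext e
  simp only [edges, Set.mem_insert_iff, Set.mem_ofPred_eq, hH, hV]
  constructor
  · rintro ⟨x, y, ⟨h | ⟨rfl, rfl⟩, rfl⟩ | ⟨h, rfl⟩⟩
    · exact .inr ⟨x, y, .inl ⟨h, rfl⟩⟩
    · exact .inl rfl
    · exact .inr ⟨x, y, .inr ⟨h, rfl⟩⟩
  · rintro (rfl | ⟨x, y, ⟨h, rfl⟩ | ⟨h, rfl⟩⟩)
    · exact ⟨a, b, .inl ⟨.inr ⟨rfl, rfl⟩, rfl⟩⟩
    · exact ⟨x, y, .inl ⟨.inl h, rfl⟩⟩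
    · exact ⟨x, y, .inr ⟨h, rfl⟩⟩

theorem Shape.edges_eq_insert_vEdge {T T' : Shape} {a b : ℤ}
    (hH : ∀ x y, T.H x y ↔ T'.H x y) (hV : ∀ x y, T.V x y ↔ T'.V x y ∨ (x = a ∧ y = b)) :
    T.edges = insert (vEdge a b) T'.edges := by
  ext e
  simp only [edges, Set.mem_insert_iff, Set.mem_ofPred_eq, hH, hV]
  constructor
  · rintro ⟨x, y, ⟨h, rfl⟩ | ⟨h | ⟨rfl, rfl⟩, rfl⟩⟩
    · exact .inr ⟨x, y, .inl ⟨h, rfl⟩⟩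
    · exact .inr ⟨x, y, .inr ⟨h, rfl⟩⟩
    · exact .inl rfl
  · rintro (rfl | ⟨x, y, ⟨h, rfl⟩ | ⟨h, rfl⟩⟩)
    · exact ⟨a, b, .inr ⟨.inr ⟨rfl, rfl⟩, rfl⟩⟩
    · exact ⟨x, y, .inl ⟨h, rfl⟩⟩
    · exact ⟨x, y, .inr ⟨.inl h, rfl⟩⟩

/-- A shape starting at `(vx, vy)` can be prolonged by a horizontal edge `hEdge a vy` at its
starting point, unless this creates a second bend. -/
theorem Shape.exists_extend_horizontal (T : Shape) {ux vx vy a : ℤ}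
    (hstart : (vx = T.ex ∧ vy = T.cy) ∨ (vx = T.cx ∧ vy = T.ey))
    (ha : (a = vx ∧ ux = vx + 1) ∨ (a = vx - 1 ∧ ux = a)) (hnew : ¬ T.H a vy)
    (hcorner : T.ex ≠ T.cx → T.ey ≠ T.cy → T.V vx vy ∨ T.V vx (vy - 1) →
      vx = T.cx ∧ vy = T.cy) :
    ∃ T' : Shape, insert (hEdge a vy) T.edges = T'.edges ∧
      ((ux = T'.ex ∧ vy = T'.cy) ∨ (ux = T'.cx ∧ vy = T'.ey)) := by
  obtain ⟨cx, cy, ex, ey⟩ := T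
  simp only [H, V] at *
  by_cases hA : vx = ex ∧ vy = cy
  · refine ⟨⟨cx, cy, ux, ey⟩, (edges_eq_insert_hEdge ?_ ?_).symm, ?_⟩ <;>
      simp only [H, V] <;> grind
  · -- otherwise the path starts at the vertical end
    by_cases hc : ey = cy
    · refine ⟨⟨ux, cy, ex, ey⟩, (edges_eq_insert_hEdge ?_ ?_).symm, ?_⟩ <;>
        simp only [H, V] <;> grind
    · have hex : ex = cx := by grind
      refine ⟨⟨cx, ey, ux, cy⟩, (edges_eq_insert_hEdge ?_ ?_).symm, ?_⟩ <;>
        simp only [H, V] <;> grind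

/-- A shape starting at `(vx, vy)` can be prolonged by a vertical edge `vEdge vx a` at its
starting point, unless this creates a second bend. -/
theorem Shape.exists_extend_vertical (T : Shape) {uy vx vy a : ℤ}
    (hstart : (vx = T.ex ∧ vy = T.cy) ∨ (vx = T.cx ∧ vy = T.ey))
    (ha : (a = vy ∧ uy = vy + 1) ∨ (a = vy - 1 ∧ uy = a)) (hnew : ¬ T.V vx a)
    (hcorner : T.ex ≠ T.cx → T.ey ≠ T.cy → T.H vx vy ∨ T.H (vx - 1) vy →
      vx = T.cx ∧ vy = T.cy) :
    ∃ T' : Shape, insert (vEdge vx a) T.edges = T'.edges ∧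
      ((vx = T'.ex ∧ uy = T'.cy) ∨ (vx = T'.cx ∧ uy = T'.ey)) := by
  obtain ⟨cx, cy, ex, ey⟩ := T
  simp only [H, V] at *
  by_cases hA : vx = cx ∧ vy = ey
  · refine ⟨⟨cx, cy, ex, uy⟩, (edges_eq_insert_vEdge ?_ ?_).symm, ?_⟩ <;>
      simp only [H, V] <;> grind
  · -- otherwise the path starts at the horizontal end
    by_cases hc : ex = cx
    · refine ⟨⟨cx, uy, ex, ey⟩, (edges_eq_insert_vEdge ?_ ?_).symm, ?_⟩ <;>
        simp only [H, V] <;> grind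
    · have hex : ey = cy := by grind
      refine ⟨⟨ex, cy, cx, uy⟩, (edges_eq_insert_vEdge ?_ ?_).symm, ?_⟩ <;>
        simp only [H, V] <;> grind

theorem BendAt.mono {E E' : Set (Sym2 (ℤ × ℤ))} (h : E ⊆ E') {x y : ℤ} (hb : BendAt E x y) :
    BendAt E' x y :=
  ⟨hb.1.imp (@h _) (@h _), hb.2.imp (@h _) (@h _)⟩

theorem Shape.bendAt_corner {T : Shape} (hx : T.ex ≠ T.cx) (hy : T.ey ≠ T.cy) :
    BendAt T.edges T.cx T.cy := by
  rw [bendAt_edges]; simp only [H, V, true_and]; omega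

/-- By induction along the path. The shape is built together with the information that the path
starts at one of its two ends, where the next edge is attached. -/
theorem exists_shape_of_walk {m n : ℕ} {u v : Fin m × Fin n} (p : (grid m n).Walk u v)
    (hp : p.IsPath)
    (hbend : ∀ x y x' y', BendAt (Sym2.map toInt '' {e | e ∈ p.edges}) x y →
      BendAt (Sym2.map toInt '' {e | e ∈ p.edges}) x' y' → x = x' ∧ y = y') :
    ∃ T : Shape, Sym2.map toInt '' {e | e ∈ p.edges} = T.edges ∧
      (((toInt u).1 = T.ex ∧ (toInt u).2 = T.cy) ∨
        ((toInt u).1 = T.cx ∧ (toInt u).2 = T.ey)) := by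
  induction p with
  | @nil u =>
    refine ⟨⟨(toInt u).1, (toInt u).2, (toInt u).1, (toInt u).2⟩, ?_, .inl ⟨rfl, rfl⟩⟩
    ext e
    simp only [SimpleGraph.Walk.edges_nil, List.not_mem_nil, Set.ofPred_false, Set.image_empty,
      Set.mem_empty_iff_false, false_iff]
    rintro ⟨x, y, ⟨h, -⟩ | ⟨h, -⟩⟩ <;> simp only [Shape.H, Shape.V] at h <;> omega
  | @cons u v w hadj p ih =>
    rw [SimpleGraph.Walk.cons_isPath_iff] at hp
    have himg : Sym2.map toInt '' {e | e ∈ (SimpleGraph.Walk.cons hadj p).edges} =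
        insert (Sym2.map toInt s(u, v)) (Sym2.map toInt '' {e | e ∈ p.edges}) := by
      rw [← Set.image_insert_eq]
      congr 1
      ext e
      simp
    rw [himg] at hbend
    obtain ⟨T, hT, hstart⟩ := ih hp.1 fun x y x' y' h h' =>
      hbend x y x' y' (h.mono (Set.subset_insert _ _)) (h'.mono (Set.subset_insert _ _))
    have hnew : Sym2.map toInt s(u, v) ∉ T.edges := by
      rw [← hT, (Sym2.map.injective toInt_injective).mem_set_image]
      exact fun h => hp.2 (p.fst_mem_support_of_mem_edges h)
    rw [himg, hT]
    rw [hT] at hbend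
    have hcorner : T.ex ≠ T.cx → T.ey ≠ T.cy →
        BendAt (insert (Sym2.map toInt s(u, v)) T.edges) (toInt v).1 (toInt v).2 →
        (toInt v).1 = T.cx ∧ (toInt v).2 = T.cy := fun h1 h2 h3 =>
      hbend _ _ _ _ h3 ((Shape.bendAt_corner h1 h2).mono (Set.subset_insert _ _))
    rw [Sym2.eq_swap] at hnew hcorner ⊢
    rcases grid_adj_iff.1 hadj with ⟨h2, h1⟩ | ⟨h1, h2⟩
    · have hx : u.2 = v.2 := by
        have := congrArg Int.toNat h2
        exact Fin.ext (by simpa [toInt] using this)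
      obtain ⟨a, he, ha⟩ : ∃ a, Sym2.map toInt s(v, u) = hEdge a (toInt v).2 ∧
          ((a = (toInt v).1 ∧ (toInt u).1 = (toInt v).1 + 1) ∨
            (a = (toInt v).1 - 1 ∧ (toInt u).1 = a)) := by
        rcases h1 with h1 | h1
        · refine ⟨(toInt v).1 - 1, ?_, by omega⟩
          simp only [Sym2.map_mk, hEdge, Sym2.eq_iff, Prod.ext_iff, and_true]
          omega
        · refine ⟨(toInt v).1, ?_, by omega⟩
          simp only [Sym2.map_mk, hEdge, Sym2.eq_iff, Prod.ext_iff, true_and]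
          omega
      rw [he] at hnew hcorner ⊢
      rw [h2]
      refine T.exists_extend_horizontal hstart ha (fun h => hnew (hEdge_mem_edges.2 h))
        fun hx hy hv => hcorner hx hy ⟨?_, ?_⟩
      · rcases ha with ⟨rfl, -⟩ | ⟨rfl, -⟩ <;> simp
      · simpa only [Set.mem_insert_iff, hEdge_ne_vEdge.symm, false_or, vEdge_mem_edges] using hv
    · obtain ⟨a, he, ha⟩ : ∃ a, Sym2.map toInt s(v, u) = vEdge (toInt v).1 a ∧
          ((a = (toInt v).2 ∧ (toInt u).2 = (toInt v).2 + 1) ∨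
            (a = (toInt v).2 - 1 ∧ (toInt u).2 = a)) := by
        rcases h2 with h2 | h2
        · refine ⟨(toInt v).2 - 1, ?_, by omega⟩
          simp only [Sym2.map_mk, vEdge, Sym2.eq_iff, Prod.ext_iff, true_and]
          omega
        · refine ⟨(toInt v).2, ?_, by omega⟩
          simp only [Sym2.map_mk, vEdge, Sym2.eq_iff, Prod.ext_iff, true_and]
          omega
      rw [he] at hnew hcorner ⊢
      rw [h1]
      refine T.exists_extend_vertical hstart ha (fun h => hnew (vEdge_mem_edges.2 h))
        fun hx hy hv => hcorner hx hy ⟨?_, ?_⟩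
      · simpa only [Set.mem_insert_iff, hEdge_ne_vEdge, false_or, hEdge_mem_edges] using hv
      · rcases ha with ⟨rfl, -⟩ | ⟨rfl, -⟩ <;> simp

/-- Every path of a grid with at most one bend has the edges of some shape. -/
theorem HostPath.exists_shape {m n : ℕ} (P : HostPath (grid m n))
    (h : {w | IsBend P w}.ncard ≤ 1) : ∃ T : Shape, Represents T P := by
  obtain ⟨T, hT, -⟩ := exists_shape_of_walk P.walk P.isPath (by
    intro x y x' y' hb hb'
    obtain ⟨w, hw, hwb⟩ := BendAt.isBend (P := P) hb
    obtain ⟨w', hw', hwb'⟩ := BendAt.isBend (P := P) hb'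
    obtain rfl := (Set.ncard_le_one_iff (Set.toFinite _)).1 h hwb hwb'
    rw [hw] at hw'
    exact Prod.mk.inj hw')
  exact ⟨T, hT⟩

/-- Translate a shape by `(a, a)`. -/
def Shape.shift (T : Shape) (a : ℤ) : Shape := ⟨T.cx + a, T.cy + a, T.ex + a, T.ey + a⟩

theorem Shape.shift_H {T : Shape} {a x y : ℤ} : (T.shift a).H x y ↔ T.H (x - a) (y - a) := by
  simp only [H, shift]; omega

theorem Shape.shift_V {T : Shape} {a x y : ℤ} : (T.shift a).V x y ↔ T.V (x - a) (y - a) := by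
  simp only [V, shift]; omega

theorem Shape.shift_sim {T T' : Shape} {a : ℤ} : (T.shift a).Sim (T'.shift a) ↔ T.Sim T' := by
  have e1 : ∀ x, x - 1 - a = x - a - 1 := fun x => by ring
  simp only [Sim, Share, Split, shift_H, shift_V, e1]
  refine and_congr ⟨?_, ?_⟩ ⟨?_, ?_⟩
  · rintro ⟨x, y, h⟩; exact ⟨x - a, y - a, h⟩
  · rintro ⟨x, y, h⟩; exact ⟨x + a, y + a, by simpa using h⟩
  · intro h x y; simpa using h (x + a) (y + a)
  · intro h x y; exact h (x - a) (y - a)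

/-- Grids are irrelevant for `B₁`-ENPG graphs: it suffices to place shapes in the integer grid. -/
theorem isBENPG_one_iff {V : Type*} [Finite V] (G : SimpleGraph V) :
    IsBENPG 1 G ↔ ∃ T : V → Shape, ∀ u v, u ≠ v → (G.Adj u v ↔ (T u).Sim (T v)) := by
  constructor
  · rintro ⟨m, n, P, hb, hadj⟩
    choose T hT using fun v => (P v).exists_shape (hb v)
    exact ⟨T, fun u v huv => (hadj u v huv).trans ((hT u).nonSplitting_iff (hT v))⟩
  · rintro ⟨T, hT⟩
    obtain ⟨M, hM⟩ : ∃ M : ℕ, ∀ v, (T v).cx.natAbs ≤ M ∧ (T v).cy.natAbs ≤ M ∧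
        (T v).ex.natAbs ≤ M ∧ (T v).ey.natAbs ≤ M := by
      obtain ⟨M, hM⟩ := (Set.finite_range fun v => (T v).cx.natAbs + (T v).cy.natAbs +
        (T v).ex.natAbs + (T v).ey.natAbs).bddAbove
      refine ⟨M, fun v => ?_⟩
      have := hM (Set.mem_range_self v)
      omega
    have hP : ∀ v, ∃ P : HostPath (grid (2 * M + 1) (2 * M + 1)),
        Represents ((T v).shift M) P ∧ {w | IsBend P w}.ncard ≤ 1 := by
      intro v
      have := hM v
      refine Shape.exists_represents _ ?_ ?_ ?_ ?_ <;> simp only [Shape.shift] <;>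
        push_cast <;> omega
    choose P hP using hP
    refine ⟨_, _, P, fun v => (hP v).2, fun u v huv => ?_⟩
    rw [hT u v huv, (hP u).1.nonSplitting_iff (hP v).1, Shape.shift_sim]


/-! ### Layouts -/

theorem Side.bar_bar (X : Side) : X.bar.bar = X := by cases X <;> rfl

/-- The requirement that a layout puts on a vertex of `S` with neighbourhood `N`, sequence `l` and
class `S_{X,C}`, by the class. -/
def Fits {V : Type*} (KP : Side → Dir → Set V) (σ : Side → Dir → List V) (N : Set V) (l : List V) :
    Side × Cls → Prop
  | (X, .H) => l <:+: σ X .H ∧ N = entries l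
  | (X, .V) => l <:+: σ X .V ∧ N = entries l
  | (X, .HH) => l <+: σ X .H ∧ N = entries l ∩ KP X.bar .H
  | (X, .HV) => l <:+ σ X .H ∧ N = entries l ∪ KP X .V

/-- Partitions `KP` of `K` with permutations `σ` of their parts, and classes `t` and sequences `τ`
for the vertices of `S` that describe all neighbourhoods. -/
structure IsLayout {V : Type*} (G : SimpleGraph V) (K S : Set V) (KP : Side → Dir → Set V)
    (σ : Side → Dir → List V) (t : V → Side × Cls) (τ : V → List V) : Prop where
  cover : ∀ X, KP X .H ∪ KP X .V = K
  disjoint : ∀ X, Disjoint (KP X .H) (KP X .V)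
  inter : KP .L .V ∩ KP .R .V = ∅
  ordering : ∀ X Y, IsOrdering (σ X Y) (KP X Y)
  fits : ∀ s ∈ S, Fits KP σ (G.neighborSet s) (τ s) (t s)

theorem IsLayout.not_mem_bar {V : Type*} {G : SimpleGraph V} {K S : Set V}
    {KP : Side → Dir → Set V} {σ : Side → Dir → List V} {t : V → Side × Cls} {τ : V → List V}
    (h : IsLayout G K S KP σ t τ) {X : Side} {v : V} (hv : v ∈ KP X .V) : v ∉ KP X.bar .V := by
  intro hv'
  have : v ∈ KP .L .V ∩ KP .R .V := by
    cases X
    · exact ⟨hv, hv'⟩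
    · exact ⟨hv', hv⟩
  rw [h.inter] at this
  exact this

theorem IsLayout.subset_bar {V : Type*} {G : SimpleGraph V} {K S : Set V}
    {KP : Side → Dir → Set V} {σ : Side → Dir → List V} {t : V → Side × Cls} {τ : V → List V}
    (h : IsLayout G K S KP σ t τ) (X : Side) : KP X .V ⊆ KP X.bar .H := by
  intro v hv
  have hK : v ∈ KP X.bar .H ∪ KP X.bar .V := by
    rw [h.cover, ← h.cover X]; exact .inr hv
  exact hK.resolve_right (h.not_mem_bar hv)

theorem entries_append {V : Type*} (l l' : List V) :
    entries (l ++ l') = entries l ∪ entries l' := by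
  ext; simp [entries]

theorem entries_nil {V : Type*} : entries ([] : List V) = ∅ := by
  ext; simp [entries]

/-- If no vertex has class `S_{X̄,HH}`, then the permutations of `K_{X,H}` and `K_{X,V}` may be
concatenated, which turns the classes `S_{X,V}` and `S_{X,HV}` into `S_{X,H}`. If some vertex has
this class, then `S_{X,HV}` has at most one element by hypothesis. -/
theorem IsLayout.exists_normal {V : Type*} {G : SimpleGraph V} {K S : Set V}
    {KP : Side → Dir → Set V} {σ : Side → Dir → List V} {t : V → Side × Cls} {τ : V → List V}
    (h : IsLayout G K S KP σ t τ)
    (hv : ∀ X, (∃ s ∈ S, t s = (X, .HH)) → {s | s ∈ S ∧ t s = (X.bar, .HV)}.Subsingleton) :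
    ∃ KP σ t τ, IsLayout G K S KP σ t τ ∧ ∀ X, {s | s ∈ S ∧ t s = (X, .HV)}.Subsingleton := by
  classical
  -- `c X`: the part `K_{X,V}` is kept
  let c : Side → Prop := fun X => ∃ s ∈ S, t s = (X.bar, .HH)
  let KP' : Side → Dir → Set V := fun X Y =>
    if c X then KP X Y else match Y with | .H => K | .V => ∅
  let σ' : Side → Dir → List V := fun X Y =>
    if c X then σ X Y else match Y with | .H => σ X .H ++ σ X .V | .V => []
  let t' : V → Side × Cls := fun s =>
    if c (t s).1 then t s else ((t s).1, if (t s).2 = .HH then .HH else .H)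
  let τ' : V → List V := fun s =>
    if c (t s).1 then τ s else if (t s).2 = .HV then τ s ++ σ (t s).1 .V else τ s
  have hent : ∀ X Y, entries (σ X Y) = KP X Y := fun X Y => (h.ordering X Y).2
  refine ⟨KP', σ', t', τ', ⟨?_, ?_, ?_, ?_, ?_⟩, ?_⟩
  · intro X
    by_cases hX : c X <;> simp [KP', hX, h.cover]
  · intro X
    by_cases hX : c X <;> simp [KP', hX, h.disjoint]
  · by_cases hL : c .L <;> by_cases hR : c .R <;> simp [KP', hL, hR, h.inter]
  · intro X Y
    by_cases hX : c X
    · simpa [KP', σ', hX] using h.ordering X Y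
    · cases Y
      · simp only [KP', σ', hX, if_false]
        refine ⟨List.nodup_append.2 ⟨(h.ordering X .H).1, (h.ordering X .V).1, ?_⟩, ?_⟩
        · rintro a ha b hb rfl
          have ha' : a ∈ KP X .H := by rw [← hent]; exact ha
          have hb' : a ∈ KP X .V := by rw [← hent]; exact hb
          exact Set.disjoint_left.1 (h.disjoint X) ha' hb'
        · rw [entries_append, hent, hent, h.cover]
      · simp only [KP', σ', hX, if_false]
        exact ⟨List.nodup_nil, entries_nil⟩
  · intro s hs
    have hf := h.fits s hs
    rcases hts : t s with ⟨X, C⟩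
    rw [hts] at hf
    by_cases hX : c X
    · have ht' : t' s = (X, C) := by simp [t', hts, hX]
      have hτ' : τ' s = τ s := by simp [τ', hts, hX]
      have hσ : ∀ Y, σ' X Y = σ X Y := fun Y => by simp [σ', hX]
      have hK : ∀ Y, KP' X Y = KP X Y := fun Y => by simp [KP', hX]
      rw [ht', hτ']
      cases C <;> simp only [Fits, hσ, hK] at hf ⊢ <;> try exact hf
      have hb : c X.bar := ⟨s, hs, by rw [hts, Side.bar_bar]⟩
      have hK' : KP' X.bar .H = KP X.bar .H := by simp [KP', hb]
      rw [hK']; exact hf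
    · have hσ : σ' X .H = σ X .H ++ σ X .V := by simp [σ', hX]
      cases C
      · have ht' : t' s = (X, .H) := by simp [t', hts, hX]
        have hτ' : τ' s = τ s := by simp [τ', hts, hX]
        rw [ht', hτ']
        simp only [Fits, hσ] at hf ⊢
        exact ⟨hf.1.trans (List.prefix_append _ _).isInfix, hf.2⟩
      · have ht' : t' s = (X, .H) := by simp [t', hts, hX]
        have hτ' : τ' s = τ s := by simp [τ', hts, hX]
        rw [ht', hτ']
        simp only [Fits, hσ] at hf ⊢
        exact ⟨hf.1.trans (List.suffix_append _ _).isInfix, hf.2⟩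
      · have ht' : t' s = (X, .HH) := by simp [t', hts, hX]
        have hτ' : τ' s = τ s := by simp [τ', hts, hX]
        have hb : c X.bar := ⟨s, hs, by rw [hts, Side.bar_bar]⟩
        have hK' : KP' X.bar .H = KP X.bar .H := by simp [KP', hb]
        rw [ht', hτ']
        simp only [Fits, hσ, hK'] at hf ⊢
        exact ⟨hf.1.trans (List.prefix_append _ _), hf.2⟩
      · have ht' : t' s = (X, .H) := by simp [t', hts, hX]
        have hτ' : τ' s = τ s ++ σ X .V := by simp [τ', hts, hX]
        rw [ht', hτ']
        simp only [Fits, hσ] at hf ⊢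
        refine ⟨?_, by rw [entries_append, hent]; exact hf.2⟩
        obtain ⟨r, hr⟩ := hf.1
        exact ⟨r, [], by rw [← hr]; simp⟩
  · intro X a ha b hb
    have key : ∀ s, s ∈ S ∧ t' s = (X, .HV) → c X ∧ s ∈ S ∧ t s = (X, .HV) := by
      rintro s ⟨hs, hts⟩
      by_cases hX : c (t s).1
      · have : t s = (X, .HV) := by simpa [t', hX] using hts
        rw [this] at hX
        exact ⟨hX, hs, this⟩
      · simp only [t', hX, if_false, Prod.mk.injEq] at hts
        split_ifs at hts <;> simp at hts
    have h1 := key a ha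
    have h2 := key b hb
    have := hv X.bar h1.1
    rw [Side.bar_bar] at this
    exact this h1.2 h2.2

/-! ### Sorted lists -/

theorem exists_ordering {V : Type*} [Finite V] (A : Set V) (f : V → ℤ) :
    ∃ σ : List V, IsOrdering σ A ∧ σ.Pairwise fun a b => f a ≤ f b := by
  classical
  let r : V → V → Prop := fun a b => f a ≤ f b
  have : Std.Total r := ⟨fun a b => le_total _ _⟩
  have : IsTrans V r := ⟨fun a b c => le_trans⟩
  refine ⟨(Set.toFinite A).toFinset.toList.insertionSort r, ⟨?_, ?_⟩, ?_⟩
  · exact (List.perm_insertionSort r _).nodup_iff.2 (Finset.nodup_toList _)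
  · ext v; simp [entries, (List.perm_insertionSort r _).mem_iff]
  · exact List.pairwise_insertionSort r _

open Classical in
theorem filter_suffix {V : Type*} (f : V → ℤ) {I : Set ℤ} (hI : IsUpperSet I) (σ : List V)
    (h : σ.Pairwise fun a b => f a ≤ f b) : σ.filter (fun v => f v ∈ I) <:+ σ := by
  induction σ with
  | nil => simp
  | cons a σ ih =>
    rw [List.pairwise_cons] at h
    by_cases ha : f a ∈ I
    · rw [List.filter_eq_self.2]
      intro b hb
      rcases List.mem_cons.1 hb with rfl | hb
      · simpa using ha
      · simpa using hI (h.1 b hb) ha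
    · rw [List.filter_cons_of_neg (by simpa using ha)]
      exact (ih h.2).trans (List.suffix_cons _ _)

open Classical in
theorem filter_prefix {V : Type*} (f : V → ℤ) {I : Set ℤ} (hI : IsLowerSet I) (σ : List V)
    (h : σ.Pairwise fun a b => f a ≤ f b) : σ.filter (fun v => f v ∈ I) <+: σ := by
  induction σ with
  | nil => simp
  | cons a σ ih =>
    rw [List.pairwise_cons] at h
    by_cases ha : f a ∈ I
    · rw [List.filter_cons_of_pos (by simpa using ha)]
      exact (List.prefix_cons_inj a).2 (ih h.2)
    · rw [List.filter_eq_nil_iff.2]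
      · exact List.nil_prefix
      · intro b hb
        rcases List.mem_cons.1 hb with rfl | hb
        · simpa using ha
        · simpa using fun hb' => ha (hI (h.1 b hb) hb')

open Classical in
/-- In a list sorted by `f`, the entries with labels in an order-connected set are consecutive. -/
theorem filter_infix {V : Type*} (f : V → ℤ) {I : Set ℤ} (hI : I.OrdConnected) (σ : List V)
    (h : σ.Pairwise fun a b => f a ≤ f b) : σ.filter (fun v => f v ∈ I) <:+: σ := by
  have h1 : σ.filter (fun v => f v ∈ I) = (σ.filter (fun v => f v ∈ lowerClosure I)).filter
      (fun v => f v ∈ upperClosure I) := by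
    rw [List.filter_filter]
    refine List.filter_congr fun v _ => ?_
    rw [← Bool.decide_and, decide_eq_decide]
    rw [← and_comm]
    exact Iff.of_eq (congrArg (f v ∈ ·) hI.upperClosure_inter_lowerClosure.symm) |>.trans
      and_comm
  rw [h1]
  refine ((filter_suffix f (upperClosure I).upper _ ?_).isInfix).trans
    (filter_prefix f (lowerClosure I).lower _ h).isInfix
  exact h.sublist List.filter_sublist

open Classical in
theorem entries_filter {V : Type*} (f : V → ℤ) (I : Set ℤ) {σ : List V} {A : Set V}
    (h : IsOrdering σ A) : entries (σ.filter fun v => f v ∈ I) = {v | v ∈ A ∧ f v ∈ I} := by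
  ext v
  rw [← h.2]
  simp [entries]

/-- The description of a neighbourhood by numerical labels in place of lists: `B X` stands for
`K_{X,V}`, the label `f X` orders `K_{X,H}` and the label `g X` orders `K_{X,V}`. -/
def Described {V : Type*} (K : Set V) (B : Side → Set V) (f g : Side → V → ℤ) (N : Set V) :
    Side × Cls → Prop
  | (X, .H) => ∃ I : Set ℤ, I.OrdConnected ∧ N = {v | v ∈ K \ B X ∧ f X v ∈ I}
  | (X, .V) => ∃ I : Set ℤ, I.OrdConnected ∧ N = {v | v ∈ B X ∧ g X v ∈ I}
  | (X, .HH) => ∃ I : Set ℤ, IsLowerSet I ∧ N = {v | v ∈ K \ B X ∧ f X v ∈ I} ∩ (K \ B X.bar)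
  | (X, .HV) => ∃ I : Set ℤ, IsUpperSet I ∧ N = {v | v ∈ K \ B X ∧ f X v ∈ I} ∪ B X

/-- Sorting by the labels turns them into a layout. -/
theorem exists_layout_of_described {V : Type*} [Finite V] {G : SimpleGraph V} {K S : Set V}
    (B : Side → Set V) (f g : Side → V → ℤ) (t : V → Side × Cls) (hB : ∀ X, B X ⊆ K)
    (hLR : B .L ∩ B .R = ∅) (h : ∀ s ∈ S, Described K B f g (G.neighborSet s) (t s)) :
    ∃ KP σ τ, IsLayout G K S KP σ t τ := by
  classical
  choose oH hoH hsH using fun X => exists_ordering (K \ B X) (f X)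
  choose oV hoV hsV using fun X => exists_ordering (B X) (g X)
  let KP : Side → Dir → Set V := fun X Y => match Y with | .H => K \ B X | .V => B X
  let σ : Side → Dir → List V := fun X Y => match Y with | .H => oH X | .V => oV X
  have hτ : ∀ s, ∃ l, s ∈ S → Fits KP σ (G.neighborSet s) l (t s) := by
    intro s
    by_cases hs : s ∈ S
    · have hd := h s hs
      generalize t s = p at hd ⊢
      obtain ⟨X, C⟩ := p
      cases C
      · obtain ⟨I, hI, hN⟩ := hd
        exact ⟨(oH X).filter fun v => f X v ∈ I, fun _ =>
          ⟨filter_infix _ hI _ (hsH X), by rw [hN, entries_filter _ _ (hoH X)]⟩⟩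
      · obtain ⟨I, hI, hN⟩ := hd
        exact ⟨(oV X).filter fun v => g X v ∈ I, fun _ =>
          ⟨filter_infix _ hI _ (hsV X), by rw [hN, entries_filter _ _ (hoV X)]⟩⟩
      · obtain ⟨I, hI, hN⟩ := hd
        exact ⟨(oH X).filter fun v => f X v ∈ I, fun _ =>
          ⟨filter_prefix _ hI _ (hsH X), by rw [hN, entries_filter _ _ (hoH X)]⟩⟩
      · obtain ⟨I, hI, hN⟩ := hd
        exact ⟨(oH X).filter fun v => f X v ∈ I, fun _ =>
          ⟨filter_suffix _ hI _ (hsH X), by rw [hN, entries_filter _ _ (hoH X)]⟩⟩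
    · exact ⟨[], fun h => (hs h).elim⟩
  choose τ hτ using hτ
  refine ⟨KP, σ, τ, ⟨?_, ?_, hLR, ?_, hτ⟩⟩
  · exact fun X => Set.sdiff_union_of_subset (hB X)
  · exact fun X => Set.disjoint_sdiff_left
  · intro X Y
    cases Y
    · exact hoH X
    · exact hoV X


/-! ### Symmetries of shapes -/

namespace Shape

/-- Reflection in a vertical line. -/
def mirror (T : Shape) : Shape := ⟨-T.cx, T.cy, -T.ex, T.ey⟩

/-- Reflection in the diagonal. -/
def swap (T : Shape) : Shape := ⟨T.cy, T.cx, T.ey, T.ex⟩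

@[simp] theorem mirror_mirror (T : Shape) : T.mirror.mirror = T := by simp [mirror]

theorem mirror_H {T : Shape} {x y : ℤ} : T.mirror.H x y ↔ T.H (-x - 1) y := by
  simp only [H, mirror]; omega

theorem mirror_V {T : Shape} {x y : ℤ} : T.mirror.V x y ↔ T.V (-x) y := by
  simp only [V, mirror]; omega

theorem Split.mirror {T T' : Shape} {x y : ℤ} (h : T.Split T' x y) :
    T.mirror.Split T'.mirror (-x) y := by
  have e2 : -(-x - 1) - 1 = x := by ring
  simp only [Split, mirror_H, mirror_V, e2, neg_neg] at h ⊢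
  grind

theorem Sim.mirror {T T' : Shape} (h : T.Sim T') : T.mirror.Sim T'.mirror := by
  obtain ⟨⟨x, y, h⟩, hs⟩ := h
  refine ⟨?_, fun x y h => hs (-x) y (by simpa using h.mirror)⟩
  rcases h with h | h
  · exact ⟨-x - 1, y, .inl (by simpa [mirror_H] using h)⟩
  · exact ⟨-x, y, .inr (by simpa [mirror_V] using h)⟩

theorem mirror_sim {T T' : Shape} : T.mirror.Sim T'.mirror ↔ T.Sim T' :=
  ⟨fun h => by simpa using h.mirror, Sim.mirror⟩

theorem swap_H {T : Shape} {x y : ℤ} : T.swap.H x y ↔ T.V y x := Iff.rfl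

theorem swap_V {T : Shape} {x y : ℤ} : T.swap.V x y ↔ T.H y x := Iff.rfl

theorem swap_sim {T T' : Shape} : T.swap.Sim T'.swap ↔ T.Sim T' := by
  have key : ∀ {A B : Shape}, A.Sim B → A.swap.Sim B.swap := by
    rintro A B ⟨⟨x, y, h⟩, hs⟩
    refine ⟨⟨y, x, h.symm⟩, fun x y h => hs y x ?_⟩
    simp only [Split, swap_H, swap_V] at h ⊢
    grind
  exact ⟨fun h => key h, key⟩

theorem Sim.symm {T T' : Shape} (h : T.Sim T') : T'.Sim T := by
  obtain ⟨⟨x, y, h⟩, hs⟩ := h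
  refine ⟨⟨x, y, h.imp And.symm And.symm⟩, fun x y h => hs x y ?_⟩
  simp only [Split] at h ⊢
  grind

/-- A straight shape may be read from its other end. -/
theorem sim_reverse_iff {P Q : Shape} (h : P.ey = P.cy) :
    Shape.Sim ⟨P.ex, P.cy, P.cx, P.cy⟩ Q ↔ P.Sim Q := by
  have hH : ∀ x y, Shape.H ⟨P.ex, P.cy, P.cx, P.cy⟩ x y ↔ P.H x y := by
    intro x y; simp only [H]; omega
  have hV : ∀ x y, Shape.V ⟨P.ex, P.cy, P.cx, P.cy⟩ x y ↔ P.V x y := by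
    intro x y; simp only [V]; omega
  simp only [Sim, Share, Split, hH, hV]

/-- The shape leaves its horizontal arm at the left end. -/
def LeftBent (T : Shape) : Prop := T.cx < T.ex ∧ T.ey ≠ T.cy

/-! ### A quantifier-free description of `∼` -/

/-- The path `Q` uses no edge at the corner of `P` besides those of `P`, if `P` has a bend there. -/
def Clear (P Q : Shape) : Prop :=
  P.ex ≠ P.cx → P.ey ≠ P.cy →
    (P.cx < P.ex → ¬ Q.H (P.cx - 1) P.cy) ∧ (P.ex < P.cx → ¬ Q.H P.cx P.cy) ∧
    (P.cy < P.ey → ¬ Q.V P.cx (P.cy - 1)) ∧ (P.ey < P.cy → ¬ Q.V P.cx P.cy)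

theorem clear_of_not_split {P Q : Shape} (h : ¬ P.Split Q P.cx P.cy) : P.Clear Q := by
  intro hx hy
  have h1 : (P.cx < P.ex ∧ P.H P.cx P.cy) ∨ (P.ex < P.cx ∧ P.H (P.cx - 1) P.cy) := by
    simp only [H, true_and]; omega
  have h2 : (P.cy < P.ey ∧ P.V P.cx P.cy) ∨ (P.ey < P.cy ∧ P.V P.cx (P.cy - 1)) := by
    simp only [V, true_and]; omega
  simp only [Split] at h
  rcases h1 with ⟨h1, h1'⟩ | ⟨h1, h1'⟩ <;> rcases h2 with ⟨h2, h2'⟩ | ⟨h2, h2'⟩ <;>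
    simp only [h1', h2', true_or, true_and, not_or, not_and] at h <;>
    refine ⟨fun h3 h4 => ?_, fun h3 h4 => ?_, fun h3 h4 => ?_, fun h3 h4 => ?_⟩ <;>
    first | omega | (simp only [h4, or_true, not_true, and_false, false_and, true_implies] at h)

theorem Split.symm {P Q : Shape} {x y : ℤ} (h : P.Split Q x y) : Q.Split P x y := by
  simp only [Split, or_comm (a := Q.H _ _), or_comm (a := Q.V _ _)]
  exact h

/-- Shapes with a common edge split only at a bend of one of them. -/
theorem sim_iff {P Q : Shape} : P.Sim Q ↔
    ((P.cy = Q.cy ∧ max (min P.cx P.ex) (min Q.cx Q.ex) < min (max P.cx P.ex) (max Q.cx Q.ex)) ∨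
      (P.cx = Q.cx ∧ max (min P.cy P.ey) (min Q.cy Q.ey) < min (max P.cy P.ey) (max Q.cy Q.ey))) ∧
    P.Clear Q ∧ Q.Clear P := by
  constructor
  · rintro ⟨⟨x, y, h⟩, hs⟩
    refine ⟨?_, clear_of_not_split (hs _ _), clear_of_not_split fun h => hs _ _ h.symm⟩
    simp only [H, V] at h
    omega
  · rintro ⟨hs, h1, h2⟩
    constructor
    · rcases hs with hs | hs
      · exact ⟨max (min P.cx P.ex) (min Q.cx Q.ex), P.cy, .inl (by simp only [H, true_and]; omega)⟩
      · exact ⟨P.cx, max (min P.cy P.ey) (min Q.cy Q.ey), .inr (by simp only [V, true_and]; omega)⟩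
    · intro x y hsp
      simp only [Split] at hsp
      simp only [H, V, Clear] at *
      rcases hs with ⟨hs, hs'⟩ | ⟨hs, hs'⟩
      · rcases hsp with ⟨ha, hb, hc⟩ | ⟨ha, hb, hc⟩ | ⟨ha, hb, hc⟩ | ⟨ha, hb, hc⟩ <;> grind
      · rcases hsp with ⟨ha, hb, hc⟩ | ⟨ha, hb, hc⟩ | ⟨ha, hb, hc⟩ | ⟨ha, hb, hc⟩ <;> grind

/-! ### Shapes against a shape through a fixed horizontal edge -/

/-- Related shapes through one horizontal edge: none extends beyond a left bend of another, and all
left bends are equal. -/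
theorem leftBent_compat {P Q : Shape} {x0 y0 : ℤ} (hP : P.H x0 y0) (hQ : Q.H x0 y0)
    (h : P.Sim Q) (hb : P.LeftBent) :
    P.cx ≤ min Q.cx Q.ex ∧ (Q.LeftBent → P.cx = Q.cx ∧ (P.cy < P.ey ↔ Q.cy < Q.ey)) := by
  have h1 := (sim_iff.1 h).2
  simp only [H, V, Clear, LeftBent] at *
  grind (splits := 25)

/-- A shape `P` on the left part of the row that does not part with the left tail of the bundle: it
is related to the shapes `Q` with a left bend, and to the others if they reach beyond its right end.
The shape `w` is one of the bundle with a left bend. -/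
theorem sim_left_tail {P Q : Shape} {x0 y0 : ℤ} (hQ : Q.H x0 y0) (hy : P.cy = y0)
    (h1 : P.cx < P.ex) (h2 : P.ex ≤ x0) {w : Shape} (hw : w.cx ≤ min Q.cx Q.ex)
    (hwQ : Q.LeftBent → w.cx = Q.cx ∧ (w.cy < w.ey ↔ Q.cy < Q.ey))
    (h : (P.ey = y0 ∧ w.cx ≤ P.cx) ∨
      (P.ey ≠ y0 ∧ w.cx = P.cx ∧ (w.cy < w.ey ↔ P.cy < P.ey))) :
    P.Sim Q ↔ (¬ Q.LeftBent ∧ -P.ex < -min Q.cx Q.ex) ∨ Q.LeftBent := by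
  rw [sim_iff]
  simp only [H, V, Clear, LeftBent] at *
  constructor
  · intro hs
    grind (splits := 25)
  · intro hc
    refine ⟨?_, fun _ _ => ⟨fun _ => ?_, fun _ => ?_, fun _ => ?_, fun _ => ?_⟩,
      fun _ _ => ⟨fun _ => ?_, fun _ => ?_, fun _ => ?_, fun _ => ?_⟩⟩ <;> grind (splits := 25)

/-- A shape `P` on the left part of the row that parts with all left bends of the bundle: it is
related to the shapes `Q` without left bend whose left end lies in a certain interval. -/
theorem sim_left_interval {P Q : Shape} {x0 y0 : ℤ} (hQ : Q.H x0 y0) (hy : P.cy = y0)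
    (h1 : P.cx < P.ex) (h2 : P.ex ≤ x0)
    (h : Q.LeftBent → ¬ ((P.ey = y0 ∧ Q.cx ≤ P.cx) ∨
      (P.ey ≠ y0 ∧ Q.cx = P.cx ∧ (Q.cy < Q.ey ↔ P.cy < P.ey)))) :
    P.Sim Q ↔ ¬ Q.LeftBent ∧ -P.ex < -min Q.cx Q.ex ∧ (P.ey ≠ y0 → -min Q.cx Q.ex ≤ -P.cx) := by
  rw [sim_iff]
  simp only [H, V, Clear, LeftBent] at *
  constructor
  · intro hs
    grind (splits := 25)
  · intro hc
    refine ⟨?_, fun _ _ => ⟨fun _ => ?_, fun _ => ?_, fun _ => ?_, fun _ => ?_⟩,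
      fun _ _ => ⟨fun _ => ?_, fun _ => ?_, fun _ => ?_, fun _ => ?_⟩⟩ <;> grind (splits := 25)

theorem not_sim_right_of_bent {P Q : Shape} {x0 y0 : ℤ} (hQ : Q.H x0 y0) (hy : P.cy = y0)
    (h1 : P.cx < P.ex) (h2 : x0 < P.cx) (h3 : P.ey ≠ y0) : ¬ P.Sim Q := by
  rw [sim_iff]
  simp only [H, V, Clear] at *
  grind (splits := 25)

/-- A shape `P` through the common edge is related to `Q` iff they part neither on the left nor on
the right. -/
theorem sim_through {P Q : Shape} {x0 y0 : ℤ} (hQ : Q.H x0 y0) (hy : P.cy = y0)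
    (h1 : P.cx ≤ x0) (h2 : x0 < P.ex) :
    P.Sim Q ↔ ((Q.LeftBent ∧ ((P.ey = y0 ∧ Q.cx ≤ P.cx) ∨
        (P.ey ≠ y0 ∧ Q.cx = P.cx ∧ (Q.cy < Q.ey ↔ P.cy < P.ey)))) ∨
      (¬ Q.LeftBent ∧ (P.ey ≠ y0 → P.cx ≤ min Q.cx Q.ex))) ∧
      (Q.mirror.LeftBent → P.ex ≤ Q.cx) := by
  rw [sim_iff]
  simp only [H, V, Clear, LeftBent, mirror] at *
  constructor
  · intro hs
    grind (splits := 25)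
  · intro hc
    refine ⟨?_, fun _ _ => ⟨fun _ => ?_, fun _ => ?_, fun _ => ?_, fun _ => ?_⟩,
      fun _ _ => ⟨fun _ => ?_, fun _ => ?_, fun _ => ?_, fun _ => ?_⟩⟩ <;> grind (splits := 25)

/-- A shape `P` without edges in the common row, on the left side, can only meet the left tail. -/
theorem sim_vertical {P Q : Shape} {x0 y0 : ℤ} (hQ : Q.H x0 y0) (hy : P.cy = y0 → P.cx = P.ex)
    (hx : P.cx ≤ x0) :
    P.Sim Q ↔ Q.LeftBent ∧ Q.cx = P.cx ∧ P.cy ≠ P.ey ∧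
      ((Q.cy < Q.ey ∧ y0 ≤ min P.cy P.ey ∧ min P.cy P.ey < y0 + (Q.ey - Q.cy).natAbs ∧
        (P.ex ≠ P.cx → P.ey < P.cy ∧ y0 + (Q.ey - Q.cy).natAbs ≤ P.cy)) ∨
      (Q.ey < Q.cy ∧ max P.cy P.ey ≤ y0 ∧ y0 - (Q.ey - Q.cy).natAbs < max P.cy P.ey ∧
        (P.ex ≠ P.cx → P.cy < P.ey ∧ P.cy ≤ y0 - (Q.ey - Q.cy).natAbs))) := by
  rw [sim_iff]
  simp only [H, V, Clear, LeftBent] at *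
  constructor
  · intro hs
    grind (splits := 25)
  · intro hc
    refine ⟨?_, fun _ _ => ⟨fun _ => ?_, fun _ => ?_, fun _ => ?_, fun _ => ?_⟩,
      fun _ _ => ⟨fun _ => ?_, fun _ => ?_, fun _ => ?_, fun _ => ?_⟩⟩ <;> grind (splits := 25)

end Shape


/-! ### Neighbourhoods from a representation -/

section Bundle

variable {V : Type*}

/-- The shapes `T v`, `v ∈ K`, are pairwise related by `∼` and all contain the edge from
`(x0, y0)` to `(x0 + 1, y0)`. -/
structure Bundle (T : V → Shape) (K : Set V) (x0 y0 : ℤ) : Prop where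
  edge : ∀ v ∈ K, (T v).H x0 y0
  sim : ∀ u ∈ K, ∀ v ∈ K, u ≠ v → (T u).Sim (T v)

/-- The vertices of `K` whose shapes bend at the left end of the common row. -/
def bent (T : V → Shape) (K : Set V) : Set V := {v | v ∈ K ∧ (T v).LeftBent}

/-- The label ordering the shapes by their left end, from right to left. -/
def near (T : V → Shape) (v : V) : ℤ := -min (T v).cx (T v).ex

/-- The length of the vertical arm. -/
def height (T : V → Shape) (v : V) : ℤ := ((T v).ey - (T v).cy).natAbs

/-- The vertices of `K` whose shapes are related to `P`. -/
def nbhd (T : V → Shape) (K : Set V) (P : Shape) : Set V := {v | v ∈ K ∧ P.Sim (T v)}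

/-- All shapes reflected. -/
def mirrored (T : V → Shape) (v : V) : Shape := (T v).mirror

@[simp] theorem mirrored_mirrored (T : V → Shape) : mirrored (mirrored T) = T := by
  funext v; simp [mirrored]

theorem nbhd_mirrored (T : V → Shape) (K : Set V) (P : Shape) :
    nbhd (mirrored T) K P.mirror = nbhd T K P := by
  simp [nbhd, mirrored, Shape.mirror_sim]

theorem Bundle.mirrored {T : V → Shape} {K : Set V} {x0 y0 : ℤ} (h : Bundle T K x0 y0) :
    Bundle (mirrored T) K (-x0 - 1) y0 := by
  refine ⟨fun v hv => ?_, fun u hu v hv huv => (h.sim u hu v hv huv).mirror⟩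
  have := h.edge v hv
  simpa [BENPG.mirrored, Shape.mirror_H] using this

theorem Bundle.compat {T : V → Shape} {K : Set V} {x0 y0 : ℤ} (h : Bundle T K x0 y0) {u v : V}
    (hu : u ∈ bent T K) (hv : v ∈ K) : (T u).cx ≤ min (T v).cx (T v).ex ∧
      ((T v).LeftBent → (T u).cx = (T v).cx ∧ ((T u).cy < (T u).ey ↔ (T v).cy < (T v).ey)) := by
  by_cases huv : u = v
  · subst huv
    have := hu.2.1
    exact ⟨by omega, fun _ => ⟨rfl, Iff.rfl⟩⟩
  · exact Shape.leftBent_compat (h.edge u hu.1) (h.edge v hv) (h.sim u hu.1 v hv huv) hu.2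

/-- How a shape `P` of class `S_{L,HH}` lies: it contains the common edge, and passes straight
through the right corner of the bundle. -/
def RunsThrough (T : V → Shape) (K : Set V) (x0 y0 : ℤ) (P : Shape) : Prop :=
  P.cy = y0 ∧ P.cx ≤ x0 ∧ ∃ w ∈ K, (T w).mirror.LeftBent ∧ (T w).cx < P.ex

/-- How a shape `P` of class `S_{L,HV}` lies: it occupies a part of the common row to the left of
the common edge, and if it reaches the left corner of the bundle, then it stops or bends with the
bundle there. -/
def RunsAlong (T : V → Shape) (K : Set V) (x0 y0 : ℤ) (P : Shape) : Prop :=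
  P.cy = y0 ∧ max P.cx P.ex ≤ x0 ∧ P.cx ≠ P.ex ∧ ∃ w ∈ bent T K,
    (P.ey = y0 ∧ (T w).cx ≤ min P.cx P.ex) ∨
    (P.ey ≠ y0 ∧ P.cx < P.ex ∧ (T w).cx = P.cx ∧ ((T w).cy < (T w).ey ↔ P.cy < P.ey))

/-- The shape `P` is of class `S_{L,C}` with respect to the bundle. -/
def HasForm (T : V → Shape) (K : Set V) (x0 y0 : ℤ) (P : Shape) : Cls → Prop
  | .H => ∃ I : Set ℤ, I.OrdConnected ∧ nbhd T K P = {v | v ∈ K \ bent T K ∧ near T v ∈ I}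
  | .V => ∃ I : Set ℤ, I.OrdConnected ∧ nbhd T K P = {v | v ∈ bent T K ∧ height T v ∈ I}
  | .HH => (∃ I : Set ℤ, IsLowerSet I ∧ nbhd T K P =
      {v | v ∈ K \ bent T K ∧ near T v ∈ I} ∩ (K \ bent (mirrored T) K)) ∧ RunsThrough T K x0 y0 P
  | .HV => (∃ I : Set ℤ, IsUpperSet I ∧ nbhd T K P =
      {v | v ∈ K \ bent T K ∧ near T v ∈ I} ∪ bent T K) ∧ RunsAlong T K x0 y0 P

variable {T : V → Shape} {K : Set V} {x0 y0 : ℤ}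

theorem HasForm.of_empty {P : Shape} (h : ∀ v ∈ K, ¬ P.Sim (T v)) : HasForm T K x0 y0 P .H := by
  refine ⟨∅, Set.ordConnected_empty, ?_⟩
  ext v
  simp only [nbhd, Set.mem_ofPred_eq, Set.mem_empty_iff_false, and_false, iff_false, not_and]
  exact h v

/-- Shapes on the left part of the common row, with the corner on the left. -/
theorem HasForm.of_left {P : Shape} (hB : Bundle T K x0 y0) (hy : P.cy = y0) (h1 : P.cx < P.ex)
    (h2 : P.ex ≤ x0) : HasForm T K x0 y0 P .HV ∨ HasForm T K x0 y0 P .H := by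
  by_cases hw : ∃ w ∈ bent T K, (P.ey = y0 ∧ (T w).cx ≤ P.cx) ∨
      (P.ey ≠ y0 ∧ (T w).cx = P.cx ∧ ((T w).cy < (T w).ey ↔ P.cy < P.ey))
  · obtain ⟨w, hwb, hw⟩ := hw
    left
    refine ⟨⟨Set.Ioi (-P.ex), isUpperSet_Ioi _, ?_⟩, hy, by omega, by omega, w, hwb, ?_⟩
    · ext v
      by_cases hv : v ∈ K
      · have hc := hB.compat hwb hv
        have := Shape.sim_left_tail (hB.edge v hv) hy h1 h2 hc.1 hc.2 hw
        simp only [nbhd, bent, near, Set.mem_ofPred_eq, Set.mem_union, Set.mem_sdiff, hv, true_and,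
          Set.mem_Ioi, this]
      · simp only [nbhd, bent, Set.mem_ofPred_eq, Set.mem_union, Set.mem_sdiff, hv, false_and,
          or_self]
    · rcases hw with hw | hw
      · exact .inl ⟨hw.1, by omega⟩
      · exact .inr ⟨hw.1, h1, hw.2⟩
  · right
    refine ⟨{z | -P.ex < z ∧ (P.ey ≠ y0 → z ≤ -P.cx)}, ?_, ?_⟩
    · refine ⟨fun a ha b hb z hz => ?_⟩
      simp only [Set.mem_ofPred_eq, Set.mem_Icc] at *
      omega
    · ext v
      by_cases hv : v ∈ K
      · have := Shape.sim_left_interval (hB.edge v hv) hy h1 h2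
          fun hb hh => hw ⟨v, ⟨hv, hb⟩, hh⟩
        simp only [nbhd, bent, near, Set.mem_ofPred_eq, Set.mem_sdiff, hv, true_and, this]
      · simp only [nbhd, Set.mem_ofPred_eq, Set.mem_sdiff, hv, false_and]

/-- Shapes on the left side without edges in the common row. -/
theorem HasForm.of_vertical {P : Shape} (hB : Bundle T K x0 y0) (hy : P.cy = y0 → P.cx = P.ex)
    (hx : P.cx ≤ x0) : HasForm T K x0 y0 P .V ∨ HasForm T K x0 y0 P .H := by
  by_cases hw : ∃ w ∈ bent T K, (T w).cx = P.cx
  · obtain ⟨w, hwb, hw⟩ := hw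
    left
    have hQ : ∀ v ∈ K, P.Sim (T v) ↔ (T v).LeftBent ∧ P.cy ≠ P.ey ∧
        (((T w).cy < (T w).ey ∧ y0 ≤ min P.cy P.ey ∧ min P.cy P.ey < y0 + height T v ∧
          (P.ex ≠ P.cx → P.ey < P.cy ∧ y0 + height T v ≤ P.cy)) ∨
        ((T w).ey < (T w).cy ∧ max P.cy P.ey ≤ y0 ∧ y0 - height T v < max P.cy P.ey ∧
          (P.ex ≠ P.cx → P.cy < P.ey ∧ P.cy ≤ y0 - height T v))) := by
      intro v hv
      rw [Shape.sim_vertical (hB.edge v hv) hy hx]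
      have hc := (hB.compat hwb hv).2
      have hwy := hwb.2.2
      simp only [height]
      constructor
      · rintro ⟨h1, -, h2⟩
        have := hc h1
        exact ⟨h1, by have := h1.2; omega⟩
      · rintro ⟨h1, h2⟩
        have := hc h1
        exact ⟨h1, by have := h1.2; omega⟩
    refine ⟨{z | P.cy ≠ P.ey ∧ (((T w).cy < (T w).ey ∧ y0 ≤ min P.cy P.ey ∧
        min P.cy P.ey < y0 + z ∧ (P.ex ≠ P.cx → P.ey < P.cy ∧ y0 + z ≤ P.cy)) ∨
      ((T w).ey < (T w).cy ∧ max P.cy P.ey ≤ y0 ∧ y0 - z < max P.cy P.ey ∧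
        (P.ex ≠ P.cx → P.cy < P.ey ∧ P.cy ≤ y0 - z)))}, ?_, ?_⟩
    · refine ⟨fun a ha b hb z hz => ?_⟩
      simp only [Set.mem_ofPred_eq, Set.mem_Icc] at *
      omega
    · ext v
      by_cases hv : v ∈ K
      · simp only [nbhd, bent, Set.mem_ofPred_eq, hv, true_and, hQ v hv]
      · simp only [nbhd, bent, Set.mem_ofPred_eq, hv, false_and]
  · right
    refine .of_empty fun v hv hs => hw ?_
    rw [Shape.sim_vertical (hB.edge v hv) hy hx] at hs
    exact ⟨v, ⟨hv, hs.1⟩, hs.2.1⟩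

/-- Shapes through the common edge, with the corner on the left. -/
theorem HasForm.of_through {P : Shape} (hB : Bundle T K x0 y0) (hy : P.cy = y0) (h1 : P.cx ≤ x0)
    (h2 : x0 < P.ex) (hmax : ∃ v ∈ K, ¬ P.Sim (T v)) :
    HasForm T K x0 y0 P .H ∨ HasForm T K x0 y0 P .HH ∨
      HasForm (mirrored T) K (-x0 - 1) y0 P.mirror .H := by
  have hQ := fun v (hv : v ∈ K) => Shape.sim_through (hB.edge v hv) hy h1 h2
  -- on the left, either no shape of `K` parts with `P`, or exactly those without left bend and
  -- with a label in some lower set do not part with `P`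
  have hl : (∀ v ∈ K, ((T v).LeftBent ∧ ((P.ey = y0 ∧ (T v).cx ≤ P.cx) ∨
        (P.ey ≠ y0 ∧ (T v).cx = P.cx ∧ ((T v).cy < (T v).ey ↔ P.cy < P.ey)))) ∨
      (¬ (T v).LeftBent ∧ (P.ey ≠ y0 → P.cx ≤ min (T v).cx (T v).ex))) ∨
    ∃ I : Set ℤ, IsLowerSet I ∧ ∀ v ∈ K, (((T v).LeftBent ∧ ((P.ey = y0 ∧ (T v).cx ≤ P.cx) ∨
        (P.ey ≠ y0 ∧ (T v).cx = P.cx ∧ ((T v).cy < (T v).ey ↔ P.cy < P.ey)))) ∨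
      (¬ (T v).LeftBent ∧ (P.ey ≠ y0 → P.cx ≤ min (T v).cx (T v).ex))) ↔
        ¬ (T v).LeftBent ∧ near T v ∈ I := by
    by_cases hw : ∃ w ∈ bent T K, (P.ey = y0 ∧ (T w).cx ≤ P.cx) ∨
      (P.ey ≠ y0 ∧ (T w).cx = P.cx ∧ ((T w).cy < (T w).ey ↔ P.cy < P.ey))
    · obtain ⟨w, hwb, hw⟩ := hw
      left
      intro v hv
      have hc := hB.compat hwb hv
      by_cases hb : (T v).LeftBent
      · have := hc.2 hb
        exact .inl ⟨hb, by omega⟩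
      · exact .inr ⟨hb, by omega⟩
    · right
      refine ⟨{z | P.ey ≠ y0 → z ≤ -P.cx}, fun a b hab ha hb => hab.trans (ha hb), ?_⟩
      intro v hv
      have : ¬ ((T v).LeftBent ∧ _) := fun h => hw ⟨v, ⟨hv, h.1⟩, h.2⟩
      simp only [near, Set.mem_ofPred_eq]
      constructor
      · rintro (h | ⟨h, h'⟩)
        · exact (this h).elim
        · exact ⟨h, by omega⟩
      · rintro ⟨h, h'⟩
        exact .inr ⟨h, by omega⟩
  -- on the right, `P` is straight: either no shape of `K` parts with `P`, or exactly those with a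
  -- right bend do
  have hr : (∀ v ∈ K, (T v).mirror.LeftBent → P.ex ≤ (T v).cx) ∨
      ((∃ w ∈ K, (T w).mirror.LeftBent ∧ (T w).cx < P.ex) ∧
        ∀ v ∈ K, ((T v).mirror.LeftBent → P.ex ≤ (T v).cx) ↔ ¬ (T v).mirror.LeftBent) := by
    by_cases hw : ∃ w ∈ K, (T w).mirror.LeftBent ∧ (T w).cx < P.ex
    · right
      refine ⟨hw, fun v hv => ⟨fun h hb => ?_, fun h hb => (h hb).elim⟩⟩
      obtain ⟨w, hwK, hwb, hw⟩ := hw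
      have h3 := ((hB.mirrored.compat ⟨hwK, hwb⟩ hv).2 hb).1
      have h4 := h hb
      simp only [mirrored, Shape.mirror] at h3
      omega
    · left
      intro v hv hb
      by_contra h
      exact hw ⟨v, hv, hb, by omega⟩
  rcases hl with hl | ⟨I, hI, hl⟩
  · rcases hr with hr | ⟨hw, hr⟩
    · obtain ⟨v, hv, hn⟩ := hmax
      exact (hn ((hQ v hv).2 ⟨hl v hv, hr v hv⟩)).elim
    · refine .inr (.inr ⟨Set.univ, Set.ordConnected_univ, ?_⟩)
      rw [nbhd_mirrored]
      ext v
      by_cases hv : v ∈ K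
      · simp only [nbhd, bent, Set.mem_ofPred_eq, hv, true_and, Set.mem_sdiff, Set.mem_univ,
          and_true, hQ v hv, hl v hv, hr v hv, mirrored]
      · simp only [nbhd, Set.mem_ofPred_eq, Set.mem_sdiff, hv, false_and]
  · rcases hr with hr | ⟨hw, hr⟩
    · refine .inl ⟨I, hI.ordConnected, ?_⟩
      ext v
      by_cases hv : v ∈ K
      · have := hr v hv
        simp only [nbhd, bent, Set.mem_ofPred_eq, hv, true_and, Set.mem_sdiff, hQ v hv, hl v hv]
        tauto
      · simp only [nbhd, Set.mem_ofPred_eq, Set.mem_sdiff, hv, false_and]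
    · refine .inr (.inl ⟨⟨I, hI, ?_⟩, hy, h1, hw⟩)
      ext v
      by_cases hv : v ∈ K
      · simp only [nbhd, bent, Set.mem_ofPred_eq, hv, true_and, Set.mem_sdiff, hQ v hv, hl v hv,
          hr v hv, mirrored, Set.mem_inter_iff]
      · simp only [nbhd, Set.mem_ofPred_eq, Set.mem_sdiff, hv, false_and, Set.mem_inter_iff]

theorem nbhd_congr {P Q : Shape} (h : ∀ R : Shape, P.Sim R ↔ Q.Sim R) :
    nbhd T K P = nbhd T K Q := by
  simp only [nbhd, h]

/-- The case of `exists_form` in which the corner of `P` is not to the right of its horizontal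
arm, or the horizontal arm does not lie on the common row. -/
theorem exists_form_of_le {P : Shape} (hB : Bundle T K x0 y0)
    (hP : P.cy = y0 → P.cx ≠ P.ex → P.cx < P.ex) (hmax : ∃ v ∈ K, ¬ P.Sim (T v)) :
    ∃ C, HasForm T K x0 y0 P C ∨ HasForm (mirrored T) K (-x0 - 1) y0 P.mirror C := by
  by_cases hrow : P.cy = y0 ∧ P.cx ≠ P.ex
  · obtain ⟨hy, hne⟩ := hrow
    have hlt := hP hy hne
    by_cases h1 : P.ex ≤ x0
    · rcases HasForm.of_left hB hy hlt h1 with h | h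
      · exact ⟨_, .inl h⟩
      · exact ⟨_, .inl h⟩
    · by_cases h2 : P.cx ≤ x0
      · rcases HasForm.of_through hB hy h2 (by omega) hmax with h | h | h
        · exact ⟨_, .inl h⟩
        · exact ⟨_, .inl h⟩
        · exact ⟨_, .inr h⟩
      · by_cases h3 : P.ey = y0
        · -- a straight path to the right of the common edge, read from its other end
          have hrev := HasForm.of_left (P := (Shape.mk P.ex P.cy P.cx P.cy).mirror) hB.mirrored hy
            (by simp only [Shape.mirror]; omega) (by simp only [Shape.mirror]; omega)
          have hn : nbhd (mirrored T) K (Shape.mk P.ex P.cy P.cx P.cy).mirror =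
              nbhd (mirrored T) K P.mirror := by
            rw [nbhd_mirrored, nbhd_mirrored]
            exact nbhd_congr fun R => Shape.sim_reverse_iff (h3.trans hy.symm)
          rcases hrev with ⟨h, h'⟩ | h
          · refine ⟨.HV, .inr ⟨by rwa [hn] at h, ?_⟩⟩
            obtain ⟨h4, h5, h6, w, hw, h7⟩ := h'
            simp only [Shape.mirror] at h4 h5 h6 h7
            refine ⟨hy, by simp only [Shape.mirror]; omega, by simp only [Shape.mirror]; omega,
              w, hw, .inl ⟨h3, ?_⟩⟩
            simp only [Shape.mirror]
            omega
          · exact ⟨.H, .inr (by unfold HasForm at h ⊢; rwa [hn] at h)⟩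
        · exact ⟨.H, .inl (.of_empty fun v hv =>
            Shape.not_sim_right_of_bent (hB.edge v hv) hy hlt (by omega) h3)⟩
  · by_cases h1 : P.cx ≤ x0
    · rcases HasForm.of_vertical hB (P := P) (by tauto) h1 with h | h
      · exact ⟨_, .inl h⟩
      · exact ⟨_, .inl h⟩
    · rcases HasForm.of_vertical hB.mirrored (P := P.mirror)
        (by simp only [Shape.mirror, neg_inj]; tauto)
        (by simp only [Shape.mirror]; omega) with h | h
      · exact ⟨_, .inr h⟩
      · exact ⟨_, .inr h⟩

/-- A shape that is not related to all shapes of the bundle belongs to one of the eight classes. -/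
theorem exists_form {P : Shape} (hB : Bundle T K x0 y0) (hmax : ∃ v ∈ K, ¬ P.Sim (T v)) :
    ∃ C, HasForm T K x0 y0 P C ∨ HasForm (mirrored T) K (-x0 - 1) y0 P.mirror C := by
  by_cases h : P.cy = y0 → P.cx ≠ P.ex → P.cx < P.ex
  · exact exists_form_of_le hB h hmax
  · obtain ⟨C, hC⟩ := exists_form_of_le (P := P.mirror) hB.mirrored
      (by simp only [Shape.mirror]; omega) (by simpa [mirrored, Shape.mirror_sim] using hmax)
    rw [mirrored_mirrored, Shape.mirror_mirror, show -(-x0 - 1) - 1 = x0 by ring] at hC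
    exact ⟨C, hC.symm⟩

/-- Shapes of class `S_{R,HV}` that do not bend are related to all shapes of class `S_{L,HH}`, and
those that bend are related to each other; so the shapes of class `S_{R,HV}` that are not related to
a given shape of class `S_{L,HH}` are pairwise related. -/
theorem sim_of_runsAlong {P Q Q' : Shape} (hB : Bundle T K x0 y0) (hP : RunsThrough T K x0 y0 P)
    (hQ : RunsAlong (mirrored T) K (-x0 - 1) y0 Q.mirror)
    (hQ' : RunsAlong (mirrored T) K (-x0 - 1) y0 Q'.mirror)
    (h : ¬ P.Sim Q) (h' : ¬ P.Sim Q') : Q.Sim Q' := by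
  obtain ⟨hPy, hPx, w, hw, hwb, hwP⟩ := hP
  have key : ∀ R : Shape, RunsAlong (mirrored T) K (-x0 - 1) y0 R.mirror → ¬ P.Sim R →
      R.cy = y0 ∧ x0 < R.ex ∧ R.ex < R.cx ∧ R.ey ≠ y0 ∧ R.cx = (T w).cx ∧
        ((T w).cy < (T w).ey ↔ R.cy < R.ey) := by
    rintro R ⟨h1, h2, h3, u, hu, h4⟩ hn
    have hc := (hB.mirrored.compat ⟨hw, hwb⟩ hu.1).2 hu.2
    simp only [mirrored, Shape.mirror] at h1 h2 h3 h4 hc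
    rcases h4 with h4 | h4
    · refine (hn (Shape.sim_iff.2 ⟨.inl (by omega), fun _ _ => ?_, fun _ h => ?_⟩)).elim
      · simp only [Shape.H, Shape.V]
        omega
      · omega
    · omega
  have h1 := key Q hQ h
  have h2 := key Q' hQ' h'
  refine Shape.sim_iff.2 ⟨.inl (by omega), fun _ _ => ?_, fun _ _ => ?_⟩ <;>
    simp only [Shape.H, Shape.V] <;> omega

end Bundle


/-! ### The common edge of a clique -/

namespace Shape

/-- The shapes have a common horizontal edge. -/
def HShare (P Q : Shape) : Prop :=
  P.cy = Q.cy ∧ max (min P.cx P.ex) (min Q.cx Q.ex) < min (max P.cx P.ex) (max Q.cx Q.ex)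

/-- The shapes have a common vertical edge. -/
def VShare (P Q : Shape) : Prop := P.swap.HShare Q.swap

theorem Sim.hShare_or_vShare {P Q : Shape} (h : P.Sim Q) : P.HShare Q ∨ P.VShare Q :=
  (sim_iff.1 h).1

/-- Related shapes with a common vertical edge and the same bend also share a horizontal edge. -/
theorem VShare.hShare_of_bent {P Q : Shape} (h : P.Sim Q) (hs : P.VShare Q) (hy : P.cy = Q.cy)
    (hP : P.cx ≠ P.ex) (hQ : Q.cx ≠ Q.ex) : P.HShare Q := by
  have hc := (sim_iff.1 h).2.1
  simp only [VShare, HShare, swap, Clear, H, V] at *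
  grind (splits := 25)

end Shape

variable {V : Type*} {T : V → Shape} {K : Set V}

/-- Among pairwise related shapes, a pair without common horizontal edge and a pair without common
vertical edge would force one of the two pairs to have the same bend, and such a pair has common
edges of both kinds. -/
theorem hShare_or_vShare_uniform (h : ∀ u ∈ K, ∀ v ∈ K, u ≠ v → (T u).Sim (T v)) :
    (∀ u ∈ K, ∀ v ∈ K, u ≠ v → (T u).HShare (T v)) ∨
      ∀ u ∈ K, ∀ v ∈ K, u ≠ v → (T u).VShare (T v) := by
  by_contra hcon
  push Not at hcon
  obtain ⟨⟨u, hu, v, hv, huv, hH⟩, u', hu', v', hv', huv', hV⟩ := hcon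
  have hs := h u hu v hv huv
  have hs' := h u' hu' v' hv' huv'
  have hVs := hs.hShare_or_vShare.resolve_left hH
  have hHs := hs'.hShare_or_vShare.resolve_right hV
  have hx : ∀ a b : V, (T a).VShare (T b) → (T a).cx = (T b).cx ∧ (T a).cy ≠ (T a).ey ∧
      (T b).cy ≠ (T b).ey := by
    intro a b hab
    simp only [Shape.VShare, Shape.HShare, Shape.swap] at hab
    omega
  have hy : ∀ a b : V, (T a).HShare (T b) → (T a).cy = (T b).cy ∧ (T a).cx ≠ (T a).ex ∧
      (T b).cx ≠ (T b).ex := by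
    intro a b hab
    simp only [Shape.HShare] at hab
    omega
  have h1 := hx u v hVs
  have h2 := hy u' v' hHs
  have key : ∀ a b, a ∈ K → b ∈ K → (a = u ∨ a = v) → (b = u' ∨ b = v') →
      ((T b).cx = (T u).cx ∧ (T b).cy ≠ (T b).ey) ∨
      ((T a).cy = (T u').cy ∧ (T a).cx ≠ (T a).ex) := by
    intro a b ha hb hau hbu
    have h3 : (T a).cx = (T u).cx ∧ (T a).cy ≠ (T a).ey := by
      rcases hau with rfl | rfl
      · exact ⟨rfl, h1.2.1⟩
      · exact ⟨h1.1.symm, h1.2.2⟩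
    have h4 : (T b).cy = (T u').cy ∧ (T b).cx ≠ (T b).ex := by
      rcases hbu with rfl | rfl
      · exact ⟨rfl, h2.2.1⟩
      · exact ⟨h2.1.symm, h2.2.2⟩
    by_cases hab : a = b
    · subst hab; exact .inl h3
    · rcases (h a ha b hb hab).hShare_or_vShare with hh | hh
      · have := hy a b hh
        exact .inr ⟨this.1.trans h4.1, this.2.1⟩
      · have := hx a b hh
        exact .inl ⟨this.1.symm.trans h3.1, this.2.2⟩
  have h5 : (((T u').cx = (T u).cx ∧ (T u').cy ≠ (T u').ey) ∧
      ((T v').cx = (T u).cx ∧ (T v').cy ≠ (T v').ey)) ∨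
      (((T u).cy = (T u').cy ∧ (T u).cx ≠ (T u).ex) ∧
      ((T v).cy = (T u').cy ∧ (T v).cx ≠ (T v).ex)) := by
    have e1 := key u u' hu hu' (.inl rfl) (.inl rfl)
    have e2 := key u v' hu hv' (.inl rfl) (.inr rfl)
    have e3 := key v u' hv hu' (.inr rfl) (.inl rfl)
    have e4 := key v v' hv hv' (.inr rfl) (.inr rfl)
    tauto
  rcases h5 with ⟨h5, h6⟩ | ⟨h5, h6⟩
  · refine hV (Shape.VShare.hShare_of_bent (P := (T u').swap) (Q := (T v').swap)
      (Shape.swap_sim.2 hs') ?_ ?_ h5.2 h6.2)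
    · exact hHs
    · exact h5.1.trans h6.1.symm
  · exact hH (Shape.VShare.hShare_of_bent hs hVs (h5.1.trans h6.1.symm) h5.2 h6.2)

/-- Helly's theorem for the horizontal arms. -/
theorem exists_bundle_of_hShare [Finite V] (hK : K.Nontrivial)
    (h : ∀ u ∈ K, ∀ v ∈ K, u ≠ v → (T u).Sim (T v))
    (hH : ∀ u ∈ K, ∀ v ∈ K, u ≠ v → (T u).HShare (T v)) : ∃ x0 y0, Bundle T K x0 y0 := by
  obtain ⟨m, hm, hmax⟩ := Set.exists_max_image K (fun v => min (T v).cx (T v).ex)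
    (Set.toFinite K) hK.nonempty
  refine ⟨min (T m).cx (T m).ex, (T m).cy, fun v hv => ?_, h⟩
  obtain ⟨w, hw, hwm⟩ := hK.exists_ne m
  have h1 := hH w hw m hm hwm
  have h2 := hmax v hv
  simp only [Shape.H]
  by_cases hvm : v = m
  · subst hvm
    simp only [Shape.HShare] at h1
    omega
  · have h3 := hH v hv m hm hvm
    simp only [Shape.HShare] at h1 h3
    omega

/-- Pairwise related shapes all pass through one edge, which is horizontal up to reflection of the
whole picture in the diagonal. -/
theorem exists_bundle [Finite V] (hK : K.Nontrivial)
    (h : ∀ u ∈ K, ∀ v ∈ K, u ≠ v → (T u).Sim (T v)) :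
    ∃ T' : V → Shape, (∀ u v, (T' u).Sim (T' v) ↔ (T u).Sim (T v)) ∧
      ∃ x0 y0, Bundle T' K x0 y0 := by
  rcases hShare_or_vShare_uniform h with hs | hs
  · exact ⟨T, fun _ _ => Iff.rfl, exists_bundle_of_hShare hK h hs⟩
  · exact ⟨fun v => (T v).swap, fun _ _ => Shape.swap_sim,
      exists_bundle_of_hShare hK (fun u hu v hv huv => Shape.swap_sim.2 (h u hu v hv huv)) hs⟩

/-! ### The layout of a representation -/

/-- The picture as seen from side `X`: it is reflected for `X = R`. -/
def view (T : V → Shape) : Side → V → Shape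
  | .L => T
  | .R => mirrored T

theorem mirrored_view (T : V → Shape) (X : Side) : mirrored (view T X) = view T X.bar := by
  cases X <;> simp [view, Side.bar]

theorem nbhd_view (X : Side) (s : V) : nbhd (view T X) K (view T X s) = nbhd T K (T s) := by
  cases X
  · rfl
  · exact nbhd_mirrored T K (T s)

/-- The abscissa of the common edge as seen from side `X`. -/
def viewX (x0 : ℤ) : Side → ℤ
  | .L => x0
  | .R => -x0 - 1

theorem viewX_bar (x0 : ℤ) (X : Side) : -(viewX x0 X) - 1 = viewX x0 X.bar := by
  cases X <;> simp [viewX, Side.bar]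

theorem Bundle.view {x0 y0 : ℤ} (h : Bundle T K x0 y0) (X : Side) :
    Bundle (view T X) K (viewX x0 X) y0 := by
  cases X
  · exact h
  · exact h.mirrored

theorem bent_inter_bent_mirrored : bent T K ∩ bent (mirrored T) K = ∅ := by
  ext v
  simp only [bent, mirrored, Shape.LeftBent, Shape.mirror, Set.mem_inter_iff, Set.mem_ofPred_eq,
    Set.mem_empty_iff_false, iff_false]
  omega

theorem HasForm.described {N : Set V} {x0 y0 : ℤ} {X : Side} {C : Cls} {s : V}
    (hN : N = nbhd T K (T s)) (h : HasForm (view T X) K (viewX x0 X) y0 (view T X s) C) :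
    Described K (fun X => bent (view T X) K) (fun X => near (view T X))
      (fun X => height (view T X)) N (X, C) := by
  subst hN
  cases C <;> simp only [HasForm, Described, nbhd_view, mirrored_view] at h ⊢
  · exact h
  · exact h
  · exact h.1
  · exact h.1

theorem HasForm.runsThrough {x0 y0 : ℤ} {P : Shape} (h : HasForm T K x0 y0 P .HH) :
    RunsThrough T K x0 y0 P := h.2

theorem HasForm.runsAlong {x0 y0 : ℤ} {P : Shape} (h : HasForm T K x0 y0 P .HV) :
    RunsAlong T K x0 y0 P := h.2

/-- Every representation yields a layout in normal form. -/
theorem exists_normal_layout_of_isBENPG [Finite V] {G : SimpleGraph V} {K S : Set V}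
    (hsplit : IsSplitGraph G K S) (hmax : ∀ s ∈ S, ∃ v ∈ K, ¬ G.Adj s v) (h : IsBENPG 1 G) :
    ∃ KP σ t τ, IsLayout G K S KP σ t τ ∧
      ∀ X, {s | s ∈ S ∧ t s = (X, Cls.HV)}.Subsingleton := by
  classical
  have hSK : ∀ s ∈ S, ∀ v, G.Adj s v → v ∈ K := by
    intro s hs v hv
    have : v ∈ K ∪ S := by rw [hsplit.union_eq]; trivial
    exact this.resolve_right fun hvS => hsplit.stable hs hvS hv.ne hv
  rcases Set.subsingleton_or_nontrivial K with hK | hK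
  · -- all neighbourhoods are empty, and a shape of `K` need not have any edge
    obtain ⟨KP, σ, τ, hl⟩ := exists_layout_of_described (G := G) (K := K) (S := S) (fun _ => ∅)
      (fun _ _ => 0) (fun _ _ => 0) (fun _ => (.L, .H)) (fun _ => Set.empty_subset _) (by simp)
      (by
        intro s hs
        refine ⟨∅, Set.ordConnected_empty, ?_⟩
        obtain ⟨w, hw, hws⟩ := hmax s hs
        ext v
        simp only [SimpleGraph.mem_neighborSet, Set.mem_empty_iff_false, and_false,
          Set.mem_ofPred_eq, iff_false]
        intro hv
        exact hws (hK hw (hSK s hs v hv) ▸ hv))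
    exact ⟨KP, σ, _, τ, hl, fun X a ha => by simp at ha⟩
  · obtain ⟨T₀, hT₀⟩ := (isBENPG_one_iff G).1 h
    obtain ⟨T, hT', x0, y0, hB⟩ := exists_bundle (T := T₀) hK fun u hu v hv huv =>
      (hT₀ u v huv).1 (hsplit.clique hu hv huv)
    have hT : ∀ u v, u ≠ v → (G.Adj u v ↔ (T u).Sim (T v)) := fun u v huv =>
      (hT₀ u v huv).trans (hT' u v).symm
    have hne : ∀ s ∈ S, ∀ v ∈ K, s ≠ v := by
      rintro s hs v hv rfl
      exact Set.disjoint_left.1 hsplit.disjoint hv hs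
    have hN : ∀ s ∈ S, G.neighborSet s = nbhd T K (T s) := by
      intro s hs
      ext v
      simp only [SimpleGraph.mem_neighborSet, nbhd, Set.mem_ofPred_eq]
      constructor
      · intro hv
        exact ⟨hSK s hs v hv, (hT s v hv.ne).1 hv⟩
      · rintro ⟨hv, hs'⟩
        exact (hT s v (hne s hs v hv)).2 hs'
    have hform : ∀ s, ∃ p : Side × Cls,
        s ∈ S → HasForm (view T p.1) K (viewX x0 p.1) y0 (view T p.1 s) p.2 := by
      intro s
      by_cases hs : s ∈ S
      · obtain ⟨v, hv, hsv⟩ := hmax s hs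
        obtain ⟨C, hC | hC⟩ := exists_form hB (P := T s)
          ⟨v, hv, fun h => hsv ((hT s v (hne s hs v hv)).2 h)⟩
        · exact ⟨(.L, C), fun _ => hC⟩
        · exact ⟨(.R, C), fun _ => hC⟩
      · exact ⟨(.L, .H), fun h => (hs h).elim⟩
    choose t ht using hform
    obtain ⟨KP, σ, τ, hl⟩ := exists_layout_of_described (G := G) (K := K) (S := S)
      (fun X => bent (view T X) K) (fun X => near (view T X)) (fun X => height (view T X)) t
      (fun X v hv => hv.1) bent_inter_bent_mirrored
      (fun s hs => (ht s hs).described (hN s hs))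
    refine hl.exists_normal ?_
    rintro X ⟨s, hs, hts⟩ a ⟨ha, hta⟩ b ⟨hb, htb⟩
    have hs' := ht s hs
    have ha' := ht a ha
    have hb' := ht b hb
    rw [hts] at hs'
    rw [hta] at ha'
    rw [htb] at hb'
    by_contra hab
    have hna : ∀ c ∈ S, t c = (X.bar, .HV) → ¬ (view T X s).Sim (view T X c) := by
      intro c hc htc hsim
      have hsc : s ≠ c := by rintro rfl; rw [hts] at htc; simp at htc
      refine hsplit.stable hs hc hsc ((hT s c hsc).2 ?_)
      cases X
      · exact hsim
      · exact Shape.mirror_sim.1 hsim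
    have hflip : ∀ c, (view T X c).mirror = view T X.bar c := fun c =>
      congrFun (mirrored_view T X) c
    have hsim := sim_of_runsAlong (hB.view X) hs'.runsThrough (Q := view T X a) (Q' := view T X b)
      (by rw [mirrored_view, viewX_bar, hflip]; exact ha'.runsAlong)
      (by rw [mirrored_view, viewX_bar, hflip]; exact hb'.runsAlong)
      (hna a ha hta) (hna b hb htb)
    refine hsplit.stable ha hb hab ((hT a b hab).2 ?_)
    cases X
    · exact hsim
    · exact Shape.mirror_sim.1 hsim


/-! ### Placing shapes for a layout -/

namespace Shape

/-- The shape of a vertex of `K`: it reaches `a` to the left and `b` to the right of the origin in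
row `0`, and then rises by `hl` at the left end or by `hr` at the right end. -/
def IsBundleShape (Q : Shape) (a b hl hr : ℤ) : Prop :=
  (Q = ⟨-a, 0, b, hl⟩ ∧ hr = 0) ∨ (Q = ⟨b, 0, -a, hr⟩ ∧ hl = 0)

theorem IsBundleShape.mirror {Q : Shape} {a b hl hr : ℤ} (h : Q.IsBundleShape a b hl hr) :
    Q.mirror.IsBundleShape b a hr hl := by
  rcases h with ⟨rfl, h⟩ | ⟨rfl, h⟩
  · right; simp [Shape.mirror, h]
  · left; simp [Shape.mirror, h]

/-- The shape of a vertex of `S_{L,C}` for the left corner at distance `B` from the origin, where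
`n` and `f` are the distances of its near and far end, measured from the origin in row `0` for the
classes `H`, `HH`, `HV` and from the corner along the tail for the class `V`. It turns away from
the bundle at the far end, except for the class `HV`, where it turns into the tail and `f` is not
used; for the class `HH` it runs straight through the right corner and `n` is not used. -/
def ofClass (B n f : ℤ) : Cls → Shape
  | .H => ⟨-f, 0, -n, -1⟩
  | .V => ⟨-B, f, -B - 1, n⟩
  | .HH => ⟨-f, 0, B + 1, -1⟩
  | .HV => ⟨-B, 0, -n, 1⟩

/-- Vertices of `K` are related. No shape bends on both sides, so all are subpaths of one path. -/
theorem IsBundleShape.sim {Q Q' : Shape} {a b hl hr a' b' hl' hr' B : ℤ}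
    (h : Q.IsBundleShape a b hl hr) (h' : Q'.IsBundleShape a' b' hl' hr')
    (ha : 0 < a ∧ a ≤ B) (hb : 0 < b ∧ b ≤ B) (ha' : 0 < a' ∧ a' ≤ B) (hb' : 0 < b' ∧ b' ≤ B)
    (hl0 : 0 ≤ hl ∧ (hl ≠ 0 → a = B)) (hr0 : 0 ≤ hr ∧ (hr ≠ 0 → b = B))
    (hl0' : 0 ≤ hl' ∧ (hl' ≠ 0 → a' = B)) (hr0' : 0 ≤ hr' ∧ (hr' ≠ 0 → b' = B)) : Q.Sim Q' := by
  rw [sim_iff]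
  rcases h with ⟨rfl, h⟩ | ⟨rfl, h⟩ <;> rcases h' with ⟨rfl, h'⟩ | ⟨rfl, h'⟩ <;>
    simp only [Clear, H, V] <;>
    refine ⟨?_, fun _ _ => ⟨fun _ => ?_, fun _ => ?_, fun _ => ?_, fun _ => ?_⟩,
      fun _ _ => ⟨fun _ => ?_, fun _ => ?_, fun _ => ?_, fun _ => ?_⟩⟩ <;> grind (splits := 25)

theorem IsBundleShape.sim_H {Q : Shape} {a b hl hr B n f : ℤ} (h : Q.IsBundleShape a b hl hr)
    (ha : 0 < a) (hb : 0 < b) (hl0 : hl ≠ 0 → a = B) (hn : 0 < n) (hnf : n < f) (hf : f < B) :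
    (ofClass B n f .H).Sim Q ↔ n < a ∧ a ≤ f := by
  rw [sim_iff]
  rcases h with ⟨rfl, h⟩ | ⟨rfl, h⟩ <;> simp only [Clear, H, V, ofClass] <;> constructor
  · intro hs; grind (splits := 25)
  · intro hc
    refine ⟨?_, fun _ _ => ⟨fun _ => ?_, fun _ => ?_, fun _ => ?_, fun _ => ?_⟩,
      fun _ _ => ⟨fun _ => ?_, fun _ => ?_, fun _ => ?_, fun _ => ?_⟩⟩ <;> grind (splits := 25)
  · intro hs; grind (splits := 25)
  · intro hc
    refine ⟨?_, fun _ _ => ⟨fun _ => ?_, fun _ => ?_, fun _ => ?_, fun _ => ?_⟩,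
      fun _ _ => ⟨fun _ => ?_, fun _ => ?_, fun _ => ?_, fun _ => ?_⟩⟩ <;> grind (splits := 25)

theorem IsBundleShape.sim_V {Q : Shape} {a b hl hr B n f : ℤ} (h : Q.IsBundleShape a b hl hr)
    (hb : 0 < b) (hl0 : 0 ≤ hl ∧ (hl ≠ 0 → a = B)) (hB : 0 < B) (hn : 0 < n) (hnf : n < f) :
    (ofClass B n f .V).Sim Q ↔ n < hl ∧ hl ≤ f := by
  rw [sim_iff]
  rcases h with ⟨rfl, h⟩ | ⟨rfl, h⟩ <;> simp only [Clear, H, V, ofClass] <;> constructor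
  · intro hs; grind (splits := 25)
  · intro hc
    refine ⟨?_, fun _ _ => ⟨fun _ => ?_, fun _ => ?_, fun _ => ?_, fun _ => ?_⟩,
      fun _ _ => ⟨fun _ => ?_, fun _ => ?_, fun _ => ?_, fun _ => ?_⟩⟩ <;> grind (splits := 25)
  · intro hs; grind (splits := 25)
  · intro hc
    refine ⟨?_, fun _ _ => ⟨fun _ => ?_, fun _ => ?_, fun _ => ?_, fun _ => ?_⟩,
      fun _ _ => ⟨fun _ => ?_, fun _ => ?_, fun _ => ?_, fun _ => ?_⟩⟩ <;> grind (splits := 25)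

theorem IsBundleShape.sim_HH {Q : Shape} {a b hl hr B n f : ℤ} (h : Q.IsBundleShape a b hl hr)
    (ha : 0 < a) (hb : 0 < b ∧ b ≤ B) (hl0 : hl ≠ 0 → a = B) (hr0 : 0 ≤ hr ∧ (hr ≠ 0 → b = B))
    (hf : 0 ≤ f) (hfB : f < B) : (ofClass B n f .HH).Sim Q ↔ a ≤ f ∧ hr = 0 := by
  rw [sim_iff]
  rcases h with ⟨rfl, h⟩ | ⟨rfl, h⟩ <;> simp only [Clear, H, V, ofClass] <;> constructor
  · intro hs; grind (splits := 25)
  · intro hc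
    refine ⟨?_, fun _ _ => ⟨fun _ => ?_, fun _ => ?_, fun _ => ?_, fun _ => ?_⟩,
      fun _ _ => ⟨fun _ => ?_, fun _ => ?_, fun _ => ?_, fun _ => ?_⟩⟩ <;> grind (splits := 25)
  · intro hs; grind (splits := 25)
  · intro hc
    refine ⟨?_, fun _ _ => ⟨fun _ => ?_, fun _ => ?_, fun _ => ?_, fun _ => ?_⟩,
      fun _ _ => ⟨fun _ => ?_, fun _ => ?_, fun _ => ?_, fun _ => ?_⟩⟩ <;> grind (splits := 25)

theorem IsBundleShape.sim_HV {Q : Shape} {a b hl hr B n f : ℤ} (h : Q.IsBundleShape a b hl hr)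
    (ha : 0 < a ∧ a ≤ B) (hb : 0 < b) (hl0 : 0 ≤ hl ∧ (hl ≠ 0 → a = B)) (hr0 : 0 ≤ hr)
    (hn : 0 < n) (hnB : n < B) : (ofClass B n f .HV).Sim Q ↔ n < a := by
  rw [sim_iff]
  rcases h with ⟨rfl, h⟩ | ⟨rfl, h⟩ <;> simp only [Clear, H, V, ofClass] <;> constructor
  · intro hs; grind (splits := 25)
  · intro hc
    refine ⟨?_, fun _ _ => ⟨fun _ => ?_, fun _ => ?_, fun _ => ?_, fun _ => ?_⟩,
      fun _ _ => ⟨fun _ => ?_, fun _ => ?_, fun _ => ?_, fun _ => ?_⟩⟩ <;> grind (splits := 25)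
  · intro hs; grind (splits := 25)
  · intro hc
    refine ⟨?_, fun _ _ => ⟨fun _ => ?_, fun _ => ?_, fun _ => ?_, fun _ => ?_⟩,
      fun _ _ => ⟨fun _ => ?_, fun _ => ?_, fun _ => ?_, fun _ => ?_⟩⟩ <;> grind (splits := 25)

/-- Two vertices of `S` on the same side are not related if their far ends differ, unless both are
of class `S_{L,HV}`. -/
theorem not_sim_same_side {B n f n' f' : ℤ} {C C' : Cls} (hC : ¬ (C = .HV ∧ C' = .HV))
    (hn : 0 < n) (hnf : n < f) (hf : f < B) (hn' : 0 < n') (hnf' : n' < f') (hf' : f' < B)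
    (hff : f ≠ f') : ¬ (ofClass B n f C).Sim (ofClass B n' f' C') := by
  rw [sim_iff]
  cases C <;> cases C' <;> simp only [Clear, H, V, ofClass] <;> grind (splits := 25)

/-- Two vertices of `S` on opposite sides are never related. -/
theorem not_sim_opposite {B n f n' f' : ℤ} {C C' : Cls}
    (hn : 0 < n) (hnf : n < f) (hf : f < B) (hn' : 0 < n') (hnf' : n' < f') (hf' : f' < B) :
    ¬ (ofClass B n f C).Sim (ofClass B n' f' C').mirror := by
  rw [sim_iff]
  cases C <;> cases C' <;> simp only [Clear, H, V, ofClass, mirror] <;> grind (splits := 25)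

end Shape

/-! ### Positions in a list -/

section

variable {V : Type*} [DecidableEq V]

theorem mem_infix_iff_idxOf {l σ : List V} (h : l <:+: σ) (hσ : σ.Nodup) (hl : l ≠ []) :
    ∃ i j, i < j ∧ j ≤ σ.length ∧ ∀ v ∈ σ, (v ∈ l ↔ i ≤ σ.idxOf v ∧ σ.idxOf v < j) := by
  obtain ⟨p, q, rfl⟩ := h
  have hpos := List.length_pos_of_ne_nil hl
  refine ⟨p.length, p.length + l.length, by omega, by simp only [List.length_append]; omega, ?_⟩
  intro v hv
  rw [List.append_assoc] at hσ hv ⊢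
  rw [List.nodup_append] at hσ
  by_cases hp : v ∈ p
  · have h1 : v ∉ l := fun h => hσ.2.2 v hp v (List.mem_append_left _ h) rfl
    rw [List.idxOf_append_of_mem hp]
    have := List.idxOf_lt_length_of_mem hp
    simp only [h1, false_iff]
    omega
  · rw [List.idxOf_append_of_notMem hp]
    by_cases hvl : v ∈ l
    · rw [List.idxOf_append_of_mem hvl]
      have := List.idxOf_lt_length_of_mem hvl
      simp only [hvl, true_iff]
      omega
    · rw [List.idxOf_append_of_notMem hvl]
      simp only [hvl, false_iff]
      omega

theorem mem_prefix_iff_idxOf {l σ : List V} (h : l <+: σ) (hσ : σ.Nodup) :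
    ∃ j, j ≤ σ.length ∧ ∀ v ∈ σ, (v ∈ l ↔ σ.idxOf v < j) := by
  by_cases hl : l = []
  · exact ⟨0, by omega, by simp [hl]⟩
  · obtain ⟨q, rfl⟩ := h
    refine ⟨l.length, by simp, fun v hv => ?_⟩
    by_cases hvl : v ∈ l
    · rw [List.idxOf_append_of_mem hvl]
      simp only [hvl, true_iff]
      exact List.idxOf_lt_length_of_mem hvl
    · rw [List.idxOf_append_of_notMem hvl]
      simp only [hvl, false_iff]
      omega

theorem mem_suffix_iff_idxOf {l σ : List V} (h : l <:+ σ) (hσ : σ.Nodup) :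
    ∃ i, i ≤ σ.length ∧ ∀ v ∈ σ, (v ∈ l ↔ i ≤ σ.idxOf v) := by
  obtain ⟨p, rfl⟩ := h
  refine ⟨p.length, by simp, fun v hv => ?_⟩
  rw [List.nodup_append] at hσ
  by_cases hp : v ∈ p
  · rw [List.idxOf_append_of_mem hp]
    have := List.idxOf_lt_length_of_mem hp
    have h1 : v ∉ l := fun h => hσ.2.2 v hp v h rfl
    simp only [h1, false_iff]
    omega
  · rw [List.idxOf_append_of_notMem hp]
    have h1 : v ∈ l := (List.mem_append.1 hv).resolve_left hp
    simp only [h1, true_iff]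
    omega

end

/-! ### The representation of a layout -/

theorem mul_add_le_mul {D i j : ℕ} (h : i < j) : (D : ℤ) * i + D ≤ D * j := by
  have : D * (i + 1) ≤ D * j := Nat.mul_le_mul_left _ h
  zify at this
  linarith

/-- Every layout in normal form yields a representation, provided that no vertex of `S` is isolated:
a shape needs a nonempty interval between its near and far end. -/
theorem isBENPG_of_normal_layout {V : Type*} [Finite V] {G : SimpleGraph V} {K S : Set V}
    (hsplit : IsSplitGraph G K S) (hne : ∀ s ∈ S, (G.neighborSet s).Nonempty)
    {KP : Side → Dir → Set V} {σ : Side → Dir → List V} {t : V → Side × Cls} {τ : V → List V}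
    (h : IsLayout G K S KP σ t τ) (hHV : ∀ X, {s | s ∈ S ∧ t s = (X, Cls.HV)}.Subsingleton) :
    IsBENPG 1 G := by
  classical
  rw [isBENPG_one_iff]
  -- a numbering of the vertices, which keeps the far ends apart
  obtain ⟨N, ⟨e⟩⟩ := Finite.exists_equiv_fin V
  let M := (σ .L .H).length + (σ .L .V).length + (σ .R .H).length + (σ .R .V).length
  have hM : ∀ X Y, (σ X Y).length ≤ M := by
    intro X Y
    cases X <;> cases Y <;> simp only [M] <;> omega
  let D := N + 5
  -- the distance of the corners from the origin, larger than all far ends in row `0`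
  let B : ℤ := D * (M + 3 : ℕ)
  let idx : Side → Dir → V → ℕ := fun X Y v => (σ X Y).idxOf v
  have hmem : ∀ X Y v, v ∈ σ X Y ↔ v ∈ KP X Y := fun X Y v => by
    rw [← (h.ordering X Y).2]; rfl
  have hidx : ∀ X Y v, v ∈ KP X Y → idx X Y v < M := fun X Y v hv =>
    (List.idxOf_lt_length_of_mem ((hmem X Y v).2 hv)).trans_le (hM X Y)
  -- the horizontal extent and the height of the shape of a vertex of `K` on side `X`
  let A : Side → V → ℤ := fun X v => if v ∈ KP X .V then B else D * (idx X .H v + 1 : ℕ)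
  let ht : Side → V → ℤ := fun X v => if v ∈ KP X .V then D * (idx X .V v + 1 : ℕ) else 0
  have hD : ∀ i j : ℕ, i < j → (D : ℤ) * i + D ≤ D * j := fun i j => mul_add_le_mul
  have hD5 : (5 : ℤ) + N = D := by simp only [D]; push_cast; ring
  have hD0 : ∀ i : ℕ, (D : ℤ) ≤ D * (i + 1 : ℕ) := fun i => by
    have := hD 0 (i + 1) (by omega)
    simpa using this
  have hH : ∀ X, ∀ v ∈ K, v ∉ KP X .V → v ∈ KP X .H := fun X v hv hn => by
    rw [← h.cover X] at hv
    exact hv.resolve_right hn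
  have hA : ∀ X, ∀ v ∈ K, (D : ℤ) ≤ A X v ∧ A X v ≤ B := by
    intro X v hv
    simp only [A]
    split_ifs with hb
    · exact ⟨hD0 (M + 2), le_rfl⟩
    · have := hidx X .H v (hH X v hv hb)
      exact ⟨hD0 _, by have := hD (idx X .H v + 1) (M + 3) (by omega); omega⟩
  have hht : ∀ X v, 0 ≤ ht X v ∧ (ht X v ≠ 0 → A X v = B) := by
    intro X v
    simp only [A, ht]
    split_ifs with hb
    · exact ⟨by positivity, fun _ => rfl⟩
    · exact ⟨le_rfl, fun h => (h rfl).elim⟩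
  let Q : V → Shape := fun v =>
    if v ∈ KP .L .V then ⟨-A .L v, 0, A .R v, ht .L v⟩ else ⟨A .R v, 0, -A .L v, ht .R v⟩
  have hQ : ∀ v, (Q v).IsBundleShape (A .L v) (A .R v) (ht .L v) (ht .R v) := by
    intro v
    by_cases hv : v ∈ KP .L .V
    · left
      have : v ∉ KP .R .V := h.not_mem_bar hv
      simp [Q, hv, ht, this]
    · right
      simp [Q, hv, ht]
  have hQv : ∀ X v, (view Q X v).IsBundleShape (A X v) (A X.bar v) (ht X v) (ht X.bar v) := by
    intro X v
    cases X
    · exact hQ v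
    · exact (hQ v).mirror
  have hS : ∀ s, ∃ n f : ℤ, ∃ j : ℕ, s ∈ S → (0 < n ∧ n < f ∧ f < B ∧ f = D * j + (e s + 2 : ℕ) ∧
      ∀ v ∈ K, G.Adj s v ↔ (Shape.ofClass B n f (t s).2).Sim (view Q (t s).1 v)) := by
    intro s
    by_cases hs : s ∈ S
    swap
    · exact ⟨0, 0, 0, fun h => (hs h).elim⟩
    have hes : ((e s : ℕ) : ℤ) < N := by exact_mod_cast (e s).2
    have hf := h.fits s hs
    have hadj : ∀ v, G.Adj s v ↔ v ∈ G.neighborSet s := fun v => Iff.rfl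
    generalize t s = p at hf ⊢
    obtain ⟨X, C⟩ := p
    have hτne : G.neighborSet s = entries (τ s) → τ s ≠ [] := by
      intro hN h0
      have := hne s hs
      rw [hN, h0, entries_nil] at this
      exact Set.not_nonempty_empty this
    have hBj : ∀ j : ℕ, j < M + 3 → (D : ℤ) * j + (e s + 2 : ℕ) < B := by
      intro j hj
      have := hD j (M + 3) hj
      push_cast
      omega
    cases C
    · obtain ⟨hτ, hN⟩ := hf
      obtain ⟨i, j, hij, hj, hv⟩ := mem_infix_iff_idxOf hτ (h.ordering X .H).1 (hτne hN)
      have hDi := hD0 i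
      have hDij := hD i j hij
      have hjM := hj.trans (hM X .H)
      push_cast at hDi
      refine ⟨D * (i + 1 : ℕ) - 1, D * j + (e s + 2 : ℕ), j, fun _ =>
        ⟨by push_cast; linarith, by push_cast; linarith, hBj j (by omega), rfl, fun v hvK => ?_⟩⟩
      rw [hadj, hN, (hQv X v).sim_H (by have := hA X v hvK; omega)
        (by have := hA X.bar v hvK; omega) (hht X v).2 (by push_cast; linarith)
        (by push_cast; linarith) (hBj j (by omega))]
      by_cases hb : v ∈ KP X .V
      · have hvH : v ∉ σ X .H := fun hh =>
          Set.disjoint_left.1 (h.disjoint X) ((hmem X .H v).1 hh) hb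
        have h1 : v ∉ entries (τ s) := fun hh => hvH (hτ.subset hh)
        have h2 := hBj j (by omega)
        simp only [h1, A, hb, if_true, false_iff]
        omega
      · have hvH := (hmem X .H v).2 (hH X v hvK hb)
        simp only [entries, Set.mem_ofPred_eq, hv v hvH, A, hb, if_false]
        change (i ≤ idx X .H v ∧ idx X .H v < j) ↔ _
        constructor
        · rintro ⟨h1, h2⟩
          have h3 := hD (idx X .H v) j h2
          have h4 : (D : ℤ) * (i + 1 : ℕ) ≤ D * (idx X .H v + 1 : ℕ) := by
            exact_mod_cast Nat.mul_le_mul_left D (by omega)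
          push_cast at h4 ⊢
          constructor <;> linarith
        · rintro ⟨h1, h2⟩
          constructor
          · by_contra hlt
            have := hD (idx X .H v) i (by omega)
            push_cast at h1
            linarith
          · by_contra hge
            have := hD j (idx X .H v + 1) (by omega)
            push_cast at h2 this
            linarith
    · obtain ⟨hτ, hN⟩ := hf
      obtain ⟨i, j, hij, hj, hv⟩ := mem_infix_iff_idxOf hτ (h.ordering X .V).1 (hτne hN)
      have hDi := hD0 i
      have hDij := hD i j hij
      have hjM := hj.trans (hM X .V)
      push_cast at hDi
      refine ⟨D * (i + 1 : ℕ) - 1, D * j + (e s + 2 : ℕ), j, fun _ =>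
        ⟨by push_cast; linarith, by push_cast; linarith, hBj j (by omega), rfl, fun v hvK => ?_⟩⟩
      rw [hadj, hN, (hQv X v).sim_V
        (by have := hA X.bar v hvK; omega) (hht X v) (by have := hA X v hvK; omega)
        (by push_cast; linarith) (by push_cast; linarith)]
      by_cases hb : v ∈ KP X .V
      · have hvV := (hmem X .V v).2 hb
        simp only [entries, Set.mem_ofPred_eq, hv v hvV, ht, hb, if_true]
        change (i ≤ idx X .V v ∧ idx X .V v < j) ↔ _
        constructor
        · rintro ⟨h1, h2⟩
          have h3 := hD (idx X .V v) j h2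
          have h4 : (D : ℤ) * (i + 1 : ℕ) ≤ D * (idx X .V v + 1 : ℕ) := by
            exact_mod_cast Nat.mul_le_mul_left D (by omega)
          push_cast at h4 ⊢
          constructor <;> linarith
        · rintro ⟨h1, h2⟩
          constructor
          · by_contra hlt
            have := hD (idx X .V v) i (by omega)
            push_cast at h1
            linarith
          · by_contra hge
            have := hD j (idx X .V v + 1) (by omega)
            push_cast at h2 this
            linarith
      · have h1 : v ∉ entries (τ s) := fun hh => hb ((hmem X .V v).1 (hτ.subset hh))
        simp only [h1, ht, hb, if_false, false_iff]
        push_cast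
        rintro ⟨h2, -⟩
        linarith
    · obtain ⟨hτ, hN⟩ := hf
      obtain ⟨j, hj, hv⟩ := mem_prefix_iff_idxOf hτ (h.ordering X .H).1
      have hjM := hj.trans (hM X .H)
      have hDj : (0 : ℤ) ≤ D * j := by positivity
      refine ⟨1, D * j + (e s + 2 : ℕ), j, fun _ =>
        ⟨by omega, by push_cast; omega, hBj j (by omega), rfl, fun v hvK => ?_⟩⟩
      rw [hadj, hN, (hQv X v).sim_HH (by have := hA X v hvK; omega)
        (by have := hA X.bar v hvK; omega) (hht X v).2 (hht X.bar v) (by push_cast; omega)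
        (hBj j (by omega))]
      have hbar : v ∈ KP X.bar .H ↔ ht X.bar v = 0 := by
        simp only [ht]
        split_ifs with hb
        · have := hD0 (idx X.bar .V v)
          have h1 : v ∉ KP X.bar .H := fun hh => Set.disjoint_left.1 (h.disjoint X.bar) hh hb
          simp only [h1, false_iff]
          omega
        · simp only [hH X.bar v hvK hb]
      refine and_congr ?_ hbar
      by_cases hb : v ∈ KP X .V
      · have hvH : v ∉ σ X .H := fun hh =>
          Set.disjoint_left.1 (h.disjoint X) ((hmem X .H v).1 hh) hb
        have h1 : v ∉ entries (τ s) := fun hh => hvH (hτ.subset hh)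
        have h2 := hBj j (by omega)
        simp only [h1, A, hb, if_true, false_iff]
        omega
      · have hvH := (hmem X .H v).2 (hH X v hvK hb)
        simp only [entries, Set.mem_ofPred_eq, hv v hvH, A, hb, if_false]
        change (idx X .H v < j) ↔ _
        constructor
        · intro h2
          have h3 := hD (idx X .H v) j h2
          push_cast
          linarith
        · intro h2
          by_contra hge
          have := hD j (idx X .H v + 1) (by omega)
          push_cast at h2 this
          linarith
    · obtain ⟨hτ, hN⟩ := hf
      obtain ⟨i, hi, hv⟩ := mem_suffix_iff_idxOf hτ (h.ordering X .H).1
      have hDi := hD0 i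
      have hiM := hi.trans (hM X .H)
      refine ⟨D * (i + 1 : ℕ) - 1, D * (i + 1 : ℕ) + (e s + 2 : ℕ), i + 1, fun _ =>
        ⟨by omega, by omega, hBj (i + 1) (by omega), rfl, fun v hvK => ?_⟩⟩
      have h2 := hBj (i + 1) (by omega)
      rw [hadj, hN, (hQv X v).sim_HV (by have := hA X v hvK; omega)
        (by have := hA X.bar v hvK; omega) (hht X v) (hht X.bar v).1 (by omega) (by omega)]
      by_cases hb : v ∈ KP X .V
      · simp only [A, hb, if_true, Set.mem_union, or_true, true_iff]
        omega
      · have hvH := (hmem X .H v).2 (hH X v hvK hb)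
        simp only [entries, Set.mem_ofPred_eq, Set.mem_union, hv v hvH, A, hb, if_false, or_false]
        change (i ≤ idx X .H v) ↔ _
        constructor
        · intro h1
          have h4 : (D : ℤ) * (i + 1 : ℕ) ≤ D * (idx X .H v + 1 : ℕ) := by
            exact_mod_cast Nat.mul_le_mul_left D (by omega)
          omega
        · intro h1
          by_contra hlt
          have := hD (idx X .H v) i (by omega)
          push_cast at h1
          linarith
  -- near end `n`, far end `f`, and the number `j` of the gap containing the far end
  choose n f j hS using hS
  let P : V → Shape := fun s => Shape.ofClass B (n s) (f s) (t s).2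
  let T : V → Shape := fun v => if v ∈ K then Q v else view P (t v).1 v
  have hKS : ∀ v, v ∉ K → v ∈ S := fun v hv => by
    have : v ∈ K ∪ S := by rw [hsplit.union_eq]; trivial
    exact this.resolve_left hv
  have hKQ : ∀ v ∈ K, T v = Q v := fun v hv => by simp [T, hv]
  have hSP : ∀ v, v ∉ K → T v = view P (t v).1 v := fun v hv => by simp [T, hv]
  have hSK : ∀ s v, s ∉ K → v ∈ K → (G.Adj s v ↔ (T s).Sim (T v)) := by
    intro s v hs hv
    rw [(hS s (hKS s hs)).2.2.2.2 v hv, hKQ v hv, hSP s hs]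
    cases (t s).1
    · rfl
    · simp only [view, mirrored]
      rw [← Shape.mirror_sim, Shape.mirror_mirror]
  have hsymm : ∀ {P Q : Shape}, P.Sim Q ↔ Q.Sim P := ⟨Shape.Sim.symm, Shape.Sim.symm⟩
  refine ⟨T, fun u v huv => ?_⟩
  by_cases hu : u ∈ K <;> by_cases hv : v ∈ K
  · rw [hKQ u hu, hKQ v hv]
    refine iff_of_true (hsplit.clique hu hv huv) ((hQ u).sim (B := B) (hQ v) ?_ ?_ ?_ ?_
      (hht .L u) (hht .R u) (hht .L v) (hht .R v))
    · have := hA .L u hu; omega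
    · have := hA .R u hu; omega
    · have := hA .L v hv; omega
    · have := hA .R v hv; omega
  · rw [G.adj_comm, hsymm]
    exact hSK v u hv hu
  · exact hSK u v hu hv
  · refine iff_of_false (hsplit.stable (hKS u hu) (hKS v hv) huv) ?_
    rw [hSP u hu, hSP v hv]
    obtain ⟨h1, h2, h3, h4, -⟩ := hS u (hKS u hu)
    obtain ⟨h1', h2', h3', h4', -⟩ := hS v (hKS v hv)
    have hfar : f u ≠ f v := by
      intro hff
      -- the far ends determine the numbers of the vertices modulo `D`
      have hu5 : (e u : ℕ) + 2 < D := by have := (e u).2; simp only [D]; omega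
      have hv5 : (e v : ℕ) + 2 < D := by have := (e v).2; simp only [D]; omega
      rw [h4, h4'] at hff
      have hn : D * j u + (e u + 2) = D * j v + (e v + 2) := by exact_mod_cast hff
      have := congrArg (· % D) hn
      simp only [Nat.mul_add_mod, Nat.mod_eq_of_lt hu5, Nat.mod_eq_of_lt hv5] at this
      exact huv (e.injective (Fin.ext (by omega)))
    have hnot : ¬ ((t u).1 = (t v).1 ∧ (t u).2 = .HV ∧ (t v).2 = .HV) := by
      rintro ⟨ha, hb, hc⟩
      exact huv (hHV (t u).1 ⟨hKS u hu, Prod.ext rfl hb⟩ ⟨hKS v hv, Prod.ext ha.symm hc⟩)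
    have hsame : (t u).1 = (t v).1 → ¬ (P u).Sim (P v) := fun hs =>
      Shape.not_sim_same_side (fun hh => hnot ⟨hs, hh⟩) h1 h2 h3 h1' h2' h3' hfar
    rcases hX : (t u).1 <;> rcases hX' : (t v).1
    · exact hsame (hX.trans hX'.symm)
    · exact Shape.not_sim_opposite h1 h2 h3 h1' h2' h3'
    · rw [hsymm]
      exact Shape.not_sim_opposite h1' h2' h3' h1 h2 h3
    · exact fun hh => hsame (hX.trans hX'.symm) (Shape.mirror_sim.1 hh)

end BENPG

open BENPG in
theorem mainTheorem1 {V : Type*} [Finite V] (G : SimpleGraph V) (K S : Set V)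
    (hsplit : IsSplitGraph G K S) (hconn : G.Connected)
    (hmax : ∀ s ∈ S, ∃ v ∈ K, ¬ G.Adj s v) :
    IsBENPG 1 G ↔
      ∃ (KP : Side → Dir → Set V) (σ : Side → Dir → List V)
        (SP : Side → Cls → Set V) (τ : V → List V),
        -- for each `X`, the sets `KP X H`, `KP X V` partition `K`
        (∀ X, KP X .H ∪ KP X .V = K ∧ Disjoint (KP X .H) (KP X .V)) ∧
        KP .L .V ∩ KP .R .V = ∅ ∧
        -- `σ X Y` is a permutation of `KP X Y`
        (∀ X Y, IsOrdering (σ X Y) (KP X Y)) ∧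
        -- the eight sets `SP X C` partition `S`
        (∀ X C, SP X C ⊆ S) ∧
        (∀ s ∈ S, ∃! p : Side × Cls, s ∈ SP p.1 p.2) ∧
        -- (i)
        (∀ X Y, ∀ s ∈ SP X (Dir.cls Y),
          τ s <:+: σ X Y ∧ G.neighborSet s = entries (τ s)) ∧
        -- (ii)
        (∀ X, ∀ s ∈ SP X .HH,
          τ s <+: σ X .H ∧ G.neighborSet s = entries (τ s) ∩ KP X.bar .H) ∧
        -- (iii)
        (∀ X, ∀ s ∈ SP X .HV,
          τ s <:+ σ X .H ∧ G.neighborSet s = entries (τ s) ∪ KP X .V) ∧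
        -- (iv)
        (∀ X, ∀ s ∈ SP X .H ∪ SP X .HH,
          {s' | s' ∈ SP X .HV ∧ Overlap (entries (τ s)) (entries (τ s'))}.ncard ≤ 1) ∧
        -- (v)
        (∀ X, (SP X .HH).Nonempty → (SP X.bar .HV).ncard ≤ 1) ∧
        -- (vi)
        (∀ X, KP X .V ⊆ KP X.bar .H) := by
  constructor
  · intro h
    obtain ⟨KP, σ, t, τ, hl, hHV⟩ := exists_normal_layout_of_isBENPG hsplit hmax h
    have hfits : ∀ X C s, s ∈ S ∧ t s = (X, C) → Fits KP σ (G.neighborSet s) (τ s) (X, C) := by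
      rintro X C s ⟨hs, hts⟩
      rw [← hts]
      exact hl.fits s hs
    refine ⟨KP, σ, fun X C => {s | s ∈ S ∧ t s = (X, C)}, τ, fun X => ⟨hl.cover X, hl.disjoint X⟩,
      hl.inter, hl.ordering, fun X C s hs => hs.1,
      fun s hs => ⟨t s, ⟨hs, rfl⟩, fun p hp => hp.2.symm⟩,
      ?_, fun X s hs => hfits X .HH s hs, fun X s hs => hfits X .HV s hs, ?_, ?_, hl.subset_bar⟩
    · intro X Y s hs
      cases Y
      · exact hfits X .H s hs
      · exact hfits X .V s hs
    · intro X s _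
      rw [Set.ncard_le_one_iff]
      exact fun ha hb => hHV X ha.1 hb.1
    · intro X _
      rw [Set.ncard_le_one_iff]
      exact fun ha hb => hHV X.bar ha hb
  · rintro ⟨KP, σ, SP, τ, hcov, hint, hord, hsub, huniq, h1, h2, h3, -, h5, -⟩
    have ht : ∀ s, ∃ p : Side × Cls, s ∈ S → s ∈ SP p.1 p.2 := by
      intro s
      by_cases hs : s ∈ S
      · obtain ⟨p, hp, -⟩ := huniq s hs
        exact ⟨p, fun _ => hp⟩
      · exact ⟨(.L, .H), fun h => (hs h).elim⟩
    choose t ht using ht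
    have hl : IsLayout G K S KP σ t τ := by
      refine ⟨fun X => (hcov X).1, fun X => (hcov X).2, hint, hord, fun s hs => ?_⟩
      have hts := ht s hs
      generalize t s = p at hts ⊢
      obtain ⟨X, C⟩ := p
      cases C
      · exact h1 X .H s hts
      · exact h1 X .V s hts
      · exact h2 X s hts
      · exact h3 X s hts
    obtain ⟨KP, σ, t, τ, hl, hHV⟩ := hl.exists_normal (by
      rintro X ⟨s, hs, hts⟩ a ⟨ha, hta⟩ b ⟨hb, htb⟩
      have h6 := h5 X ⟨s, by have := ht s hs; rwa [hts] at this⟩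
      rw [Set.ncard_le_one_iff] at h6
      refine h6 ?_ ?_
      · have := ht a ha; rwa [hta] at this
      · have := ht b hb; rwa [htb] at this)
    refine isBENPG_of_normal_layout hsplit (fun s hs => ?_) hl hHV
    -- `s` is not the only vertex, since some vertex of `K` exists
    obtain ⟨v, hv, -⟩ := hmax s hs
    have hsv : s ≠ v := fun h => Set.disjoint_left.1 hsplit.disjoint hv (h ▸ hs)
    have : Nontrivial V := ⟨s, v, hsv⟩
    exact hconn.preconnected.exists_adj_of_nontrivial s
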